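/- Let $0<r<n$, let $\alpha,\beta\in\mathbb C$, let $C$ be a complex $r\times(n-r)$ matrix and $D$ a complex $(n-r)\times r$ matrix, and let $$A=\begin{bmatrix}\alpha I_r & C\\ D&\beta I_{n-r}\end{bmatrix}.$$ For $\theta\in[0,2\pi)$ put $M_{C,D}(\theta)=C^*C+DD^*+2\,\mathrm{Re}(e^{-2i\theta}DC)$, where $\mathrm{Re}(X)=\frac12(X+X^*)$, and let $M(\theta)=M_{C,D}(\theta)$ if $n\le 2r$ and $M(\theta)=M_{D,C}(\theta)$ if $n>2r$. For $1\le k\le n$ let $\Lambda_k(A)$ be the rank-$k$ numerical range of $A$, that is, the set of all $\lambda\in\mathbb C$ such that $PAP=\lambda P$ for some orthogonal projection $P$ of rank $k$, and let $W(A)=\{x^*Ax : x\in\mathbb C^n,\ x^*x=1\}$. For $s\ge 0$ let $E(\alpha,\beta;s)=\{z\in\mathbb C: |z-\alpha|+|z-\beta|\le\sqrt{|\alpha-\beta|^2+s^2}\}$ be the closed elliptical disc with foci $\alpha,\beta$ and minor axis of length $s$ (the closed disc with centre $\alpha$ and radius $s/2$ if $\alpha=\beta$; the segment $[\alpha,\beta]$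 if $s=0$). Suppose that the spectrum of $M(\theta)$ does not depend on $\theta$, and let $\mu_1\ge\dots\ge\mu_p$ be the nonzero eigenvalues of $M(0)$, counted with multiplicities. Then, for $1\le k\le n$: * $\Lambda_k(A)=E(\alpha,\beta;\sqrt{\mu_k})$ if $1\le k\le p$; * $\Lambda_k(A)=[\alpha,\beta]$ if $p<k\le\min(r,n-r)$; * $\Lambda_k(A)=\{\alpha\}$ if $n-r<k\le r$, and $\Lambda_k(A)=\{\beta\}$ if $r<k\le n-r$; * if $\max(r,n-r)<k\le n$, then $\Lambda_k(A)=\emptyset$, except when $\alpha=\beta$ and $k\le n-p$, in which case $\Lambda_k(A)=\{\alpha\}$. In particular, $W(A)=E(\alpha,\beta;\|C+D^*\|)$, where $\|\cdot\|$ is the spectral norm. -/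

import Mathlib

open scoped Matrix Matrix.Norms.L2Operator

/-- The real part `(X + X*) / 2` of a complex square matrix. -/
noncomputable def matRe {m : Type*} (X : Matrix m m ℂ) : Matrix m m ℂ :=
  (1 / 2 : ℂ) • (X + Xᴴ)

/-- The numerical range `W(A)`: the values `⟨A x, x⟩ = x* A x` at unit vectors `x`. -/
def numRange {m : Type*} [Fintype m] (A : Matrix m m ℂ) : Set ℂ :=
  {z | ∃ x : m → ℂ, star x ⬝ᵥ x = 1 ∧ star x ⬝ᵥ (A *ᵥ x) = z}

/-- The rank-`k` numerical range `Λ_k(A)`: all `z` such that `P A P = z P` for some orthogonal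
projection `P` of rank `k`. -/
def rankNumRange {m : Type*} [Fintype m] (k : ℕ) (A : Matrix m m ℂ) : Set ℂ :=
  {z | ∃ P : Matrix m m ℂ, IsStarProjection P ∧ P.rank = k ∧ P * A * P = z • P}

/-- The block matrix with scalar diagonal blocks `α I_r`, `β I_s` and off-diagonal blocks
`C`, `D`. Its order is `n = r + s`. -/
def scalarDiagBlocks {r s : ℕ} (α β : ℂ) (C : Matrix (Fin r) (Fin s) ℂ)
    (D : Matrix (Fin s) (Fin r) ℂ) : Matrix (Fin r ⊕ Fin s) (Fin r ⊕ Fin s) ℂ :=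
  Matrix.fromBlocks (α • 1) C D (β • 1)

/-- `M_{C,D}(θ) = C* C + D D* + 2 Re (e^{-2iθ} D C)`. -/
noncomputable def blockM {r s : ℕ} (C : Matrix (Fin r) (Fin s) ℂ)
    (D : Matrix (Fin s) (Fin r) ℂ) (θ : ℝ) : Matrix (Fin s) (Fin s) ℂ :=
  Cᴴ * C + D * Dᴴ + (2 : ℂ) • matRe (Complex.exp (-2 * Complex.I * θ) • (D * C))

/-- The spectrum (a set of complex numbers) of `M(θ)` is the same for all `θ ∈ [0, 2π)`. -/
def SpectrumIndependent {m : Type*} [Fintype m] [DecidableEq m] (M : ℝ → Matrix m m ℂ) : Prop :=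
  ∀ θ ∈ Set.Ico 0 (2 * Real.pi), ∀ θ' ∈ Set.Ico 0 (2 * Real.pi),
    spectrum ℂ (M θ) = spectrum ℂ (M θ')

/-- `μ` lists, in non-increasing order, the nonzero eigenvalues of `X` counted with their
multiplicities: all eigenvalues of `X` are those in the list and a number of zeros. -/
def ListsNonzeroEigenvalues {m : Type*} [Fintype m] [DecidableEq m] (X : Matrix m m ℂ) {p : ℕ}
    (μ : Fin p → ℝ) : Prop :=
  Antitone μ ∧ (∀ j, μ j ≠ 0) ∧
    ∃ q : ℕ, X.charpoly.roots =
      Multiset.map (fun j => (μ j : ℂ)) Finset.univ.val + Multiset.replicate q 0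

/-- The closed elliptical disc `E(α, β; s)` with foci `α`, `β` and minor axis of length `s ≥ 0`.
The major axis has length `√(|α - β|² + s²)`, and the disc consists of the points whose distances
to the foci add up to at most that length. For `α = β` it is the disc of centre `α` and
radius `s / 2`; for `s = 0` it is the segment `[α, β]`. -/
def ellipticalDisc (α β : ℂ) (s : ℝ) : Set ℂ :=
  {z | ‖z - α‖ + ‖z - β‖ ≤ Real.sqrt (‖α - β‖ ^ 2 + s ^ 2)}

/-! ### Rank-`k` numerical ranges through isotropic subspaces. -/

section RankNumericalRange

open scoped ComplexOrder

variable {m l : Type*} [Fintype m] [Fintype l]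

/-! A point z lies in Λ_k(A) exactly when the form of B = A - z vanishes on a subspace of dimension
k. B has the same block shape, with a = α - z and b = β - z on the diagonal. Put N_w = C + wD*; then
M_{C,D}(θ) = N_w* N_w for w = e^{2iθ}. By continuity the constant spectrum is constant with
multiplicities. Exchanging the two blocks reduces everything to s ≤ r.

Ellipse inside Λ_k: if B is invertible, its cosquare B^{-*}B preserves the form, so the generalized
eigenspaces inside the unit circle span an isotropic subspace, and so do those outside
(`exists_isotropic_of_det_eq`). Here det(B - lB*) is a product of (a - l ā)^{r-s}, of the quadratics
(a - l ā)(b - l b̄) + lμ_j, and of q further factors with μ = 0. For z strictly inside the ellipse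
of μ_k the first k quadratics have no unimodular zero, which leaves 2k eigenvalues off the circle
(`ConstantSpectrum.mem_rankNumRange`). Closedness of Λ_k supplies the rest of the ellipse.

Λ_k inside the ellipse: for z outside, a rotation of B has negative definite real part on the
vectors whose second block avoids the large eigenvectors of N_w* N_w, for a suitable w. A larger
isotropic subspace would meet these vectors (`ConstantSpectrum.le_of_mem_rankNumRange`).

The segment lies in Λ_k for all k ≤ s whatever C and D are, by perturbation to an invertible pencil
(`segment_subset_rankNumRange`). When k exceeds a block size, an isotropic subspace meets the other
block, which pins z to a focus. When α = β, the bound n - p comes from a positive subspace of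
dimension p, and it is attained by a subspace built from the kernels of all N_w
(`ConstantSpectrum.left_mem_rankNumRange`). -/

theorem exists_isometry_of_le_finrank {k : ℕ} (S : Submodule ℂ (m → ℂ))
    (hk : k ≤ Module.finrank ℂ S) :
    ∃ V : Matrix m (Fin k) ℂ, Vᴴ * V = 1 ∧ ∀ j, V.col j ∈ S := by
  classical
  let e : EuclideanSpace ℂ m ≃ₗ[ℂ] (m → ℂ) := WithLp.linearEquiv 2 ℂ (m → ℂ)
  let S' : Submodule ℂ (EuclideanSpace ℂ m) := S.comap e.toLinearMap
  have hfin : Module.finrank ℂ S' = Module.finrank ℂ S := by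
    have : S' = S.map e.symm.toLinearMap := Submodule.comap_equiv_eq_map_symm e S
    rw [this]
    exact LinearEquiv.finrank_map_eq e.symm S
  let b := stdOrthonormalBasis ℂ S'
  have hk' : k ≤ Module.finrank ℂ S' := by omega
  refine ⟨Matrix.of fun i j => (b (Fin.castLE hk' j) : EuclideanSpace ℂ m) i, ?_, ?_⟩
  · ext i j
    have h := orthonormal_iff_ite.mp b.orthonormal (Fin.castLE hk' i) (Fin.castLE hk' j)
    rw [Submodule.coe_inner, EuclideanSpace.inner_eq_star_dotProduct] at h
    rw [Matrix.mul_apply, Matrix.one_apply]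
    simp only [Fin.castLE_inj] at h
    rw [← h, dotProduct]
    refine Finset.sum_congr rfl fun x _ => ?_
    simp [mul_comm]
  · intro j
    exact (b (Fin.castLE hk' j)).2

theorem mem_rankNumRange_of_isometry {k : ℕ} {A : Matrix m m ℂ} {z : ℂ}
    (V : Matrix m (Fin k) ℂ) (hV : Vᴴ * V = 1) (hA : Vᴴ * A * V = z • 1) :
    z ∈ rankNumRange k A := by
  refine ⟨V * Vᴴ, ⟨?_, ?_⟩, ?_, ?_⟩
  · change V * Vᴴ * (V * Vᴴ) = V * Vᴴ
    calc V * Vᴴ * (V * Vᴴ) = V * (Vᴴ * V) * Vᴴ := by simp only [Matrix.mul_assoc]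
      _ = V * Vᴴ := by rw [hV, Matrix.mul_one]
  · change (V * Vᴴ)ᴴ = V * Vᴴ
    rw [Matrix.conjTranspose_mul, Matrix.conjTranspose_conjTranspose]
  · rw [Matrix.rank_self_mul_conjTranspose, ← Matrix.rank_conjTranspose_mul_self, hV,
      Matrix.rank_one, Fintype.card_fin]
  · calc V * Vᴴ * A * (V * Vᴴ) = V * (Vᴴ * A * V) * Vᴴ := by simp only [Matrix.mul_assoc]
      _ = z • (V * Vᴴ) := by simp [hA]

theorem mem_rankNumRange_of_subspace {k : ℕ} {A : Matrix m m ℂ} {z : ℂ}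
    (S : Submodule ℂ (m → ℂ)) (hk : k ≤ Module.finrank ℂ S)
    (hS : ∀ x ∈ S, ∀ y ∈ S, star x ⬝ᵥ (A *ᵥ y) = z * (star x ⬝ᵥ y)) :
    z ∈ rankNumRange k A := by
  obtain ⟨V, hV, hVS⟩ := exists_isometry_of_le_finrank S hk
  refine mem_rankNumRange_of_isometry V hV ?_
  rw [← hV]
  ext i j
  have h := hS _ (hVS i) _ (hVS j)
  rw [Matrix.smul_apply, Matrix.mul_assoc, Matrix.mul_apply, Matrix.mul_apply]
  exact h

theorem exists_subspace_of_mem_rankNumRange {k : ℕ} {A : Matrix m m ℂ} {z : ℂ}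
    (hz : z ∈ rankNumRange k A) :
    ∃ S : Submodule ℂ (m → ℂ), Module.finrank ℂ S = k ∧
      ∀ x ∈ S, ∀ y ∈ S, star x ⬝ᵥ (A *ᵥ y) = z * (star x ⬝ᵥ y) := by
  obtain ⟨P, ⟨hP, hP'⟩, hr, h⟩ := hz
  replace hP : P * P = P := hP
  replace hP' : Pᴴ = P := hP'
  refine ⟨LinearMap.range P.mulVecLin, hr, ?_⟩
  rintro _ ⟨x, rfl⟩ _ ⟨y, rfl⟩
  simp only [Matrix.mulVecLin_apply]
  rw [Matrix.star_mulVec, hP', ← Matrix.dotProduct_mulVec, ← Matrix.dotProduct_mulVec,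
    Matrix.mulVec_mulVec, Matrix.mulVec_mulVec, Matrix.mulVec_mulVec, hP, h, Matrix.smul_mulVec,
    dotProduct_smul, smul_eq_mul]

theorem exists_isometry_of_mem_rankNumRange {k : ℕ} {A : Matrix m m ℂ} {z : ℂ}
    (hz : z ∈ rankNumRange k A) :
    ∃ V : Matrix m (Fin k) ℂ, Vᴴ * V = 1 ∧ Vᴴ * A * V = z • 1 := by
  obtain ⟨S, hk, hS⟩ := exists_subspace_of_mem_rankNumRange hz
  obtain ⟨V, hV, hVS⟩ := exists_isometry_of_le_finrank S hk.ge
  refine ⟨V, hV, ?_⟩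
  rw [← hV]
  ext i j
  have h := hS _ (hVS i) _ (hVS j)
  rw [Matrix.smul_apply, Matrix.mul_assoc, Matrix.mul_apply, Matrix.mul_apply]
  exact h

theorem rankNumRange_anti {j k : ℕ} (hjk : j ≤ k) (A : Matrix m m ℂ) :
    rankNumRange k A ⊆ rankNumRange j A := by
  intro z hz
  obtain ⟨S, hk, hS⟩ := exists_subspace_of_mem_rankNumRange hz
  exact mem_rankNumRange_of_subspace S (hk ▸ hjk) hS

theorem rankNumRange_compression_subset [DecidableEq l] {k : ℕ} (A : Matrix m m ℂ)
    (L : Matrix m l ℂ) (hL : Lᴴ * L = 1) :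
    rankNumRange k (Lᴴ * A * L) ⊆ rankNumRange k A := by
  intro z hz
  obtain ⟨V, hV, h⟩ := exists_isometry_of_mem_rankNumRange hz
  refine mem_rankNumRange_of_isometry (L * V) ?_ ?_
  · rw [Matrix.conjTranspose_mul, Matrix.mul_assoc, ← Matrix.mul_assoc Lᴴ, hL, Matrix.one_mul, hV]
  · rw [Matrix.conjTranspose_mul, ← h]
    simp only [Matrix.mul_assoc]

theorem rankNumRange_subset_submatrix (k : ℕ) (A : Matrix m m ℂ) (e : l ≃ m) :
    rankNumRange k A ⊆ rankNumRange k (A.submatrix e e) := by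
  intro z hz
  obtain ⟨V, hV, h⟩ := exists_isometry_of_mem_rankNumRange hz
  refine mem_rankNumRange_of_isometry (V.submatrix e id) ?_ ?_
  · rw [Matrix.conjTranspose_submatrix, Matrix.submatrix_mul_equiv, hV]; rfl
  · rw [Matrix.conjTranspose_submatrix, Matrix.submatrix_mul_equiv, Matrix.submatrix_mul_equiv,
      h]; rfl

theorem rankNumRange_submatrix (k : ℕ) (A : Matrix m m ℂ) (e : l ≃ m) :
    rankNumRange k (A.submatrix e e) = rankNumRange k A := by
  refine Set.Subset.antisymm ?_ (rankNumRange_subset_submatrix k A e)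
  have h := rankNumRange_subset_submatrix k (A.submatrix e e) e.symm
  have hA : (A.submatrix e e).submatrix e.symm e.symm = A := by ext; simp
  rwa [hA] at h

theorem isCompact_isometries [DecidableEq l] :
    IsCompact {V : Matrix m l ℂ | Vᴴ * V = 1} := by
  classical
  refine Metric.isCompact_of_isClosed_isBounded ?_ ?_
  · exact isClosed_eq (by fun_prop) continuous_const
  · refine (Metric.isBounded_iff_subset_closedBall 0).2 ⟨‖(1 : Matrix l l ℂ)‖ + 1, ?_⟩
    intro V hV
    have h := Matrix.l2_opNorm_conjTranspose_mul_self V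
    rw [hV] at h
    rw [mem_closedBall_zero_iff]
    nlinarith [norm_nonneg V, norm_nonneg (1 : Matrix l l ℂ), sq_nonneg (‖V‖ - 1)]

/-- Projection along the compact set of isometries is a closed map. Joint closedness in matrix and
point allows both to be perturbed away from degenerate values. -/
theorem isClosed_rankNumRange_graph (k : ℕ) :
    IsClosed {q : Matrix m m ℂ × ℂ | q.2 ∈ rankNumRange k q.1} := by
  classical
  let K : Set (Matrix m (Fin k) ℂ) := {V | Vᴴ * V = 1}
  have hK : CompactSpace K := isCompact_iff_compactSpace.mp isCompact_isometries
  let F : Set (K × (Matrix m m ℂ × ℂ)) :=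
    {q | (q.1 : Matrix m (Fin k) ℂ)ᴴ * q.2.1 * (q.1 : Matrix m (Fin k) ℂ) = q.2.2 • 1}
  have hF : IsClosed F := isClosed_eq (by fun_prop) (by fun_prop)
  convert! isClosedMap_snd_of_compactSpace F hF
  ext ⟨A, z⟩
  constructor
  · intro hz
    obtain ⟨V, hV, h⟩ := exists_isometry_of_mem_rankNumRange hz
    exact ⟨(⟨V, hV⟩, (A, z)), h, rfl⟩
  · rintro ⟨⟨⟨V, hV⟩, q⟩, h, rfl⟩
    exact mem_rankNumRange_of_isometry V hV h

theorem isClosed_rankNumRange (k : ℕ) (A : Matrix m m ℂ) : IsClosed (rankNumRange k A) :=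
  (isClosed_rankNumRange_graph k).preimage (f := fun z : ℂ => (A, z)) (by fun_prop)

theorem numRange_eq_rankNumRange_one (A : Matrix m m ℂ) : numRange A = rankNumRange 1 A := by
  ext z
  constructor
  · rintro ⟨x, hx, hz⟩
    refine mem_rankNumRange_of_isometry (Matrix.of fun i _ => x i) ?_ ?_
    · ext i j
      rw [Subsingleton.elim j i, Matrix.one_apply_eq, ← hx]
      rfl
    · ext i j
      rw [Subsingleton.elim j i, Matrix.mul_assoc, Matrix.smul_apply, Matrix.one_apply_eq, ← hz,
        smul_eq_mul, mul_one]
      rfl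
  · intro hz
    obtain ⟨V, hV, h⟩ := exists_isometry_of_mem_rankNumRange hz
    refine ⟨V.col 0, ?_, ?_⟩
    · exact congrFun (congrFun hV 0) 0
    · have := congrFun (congrFun h 0) 0
      rw [Matrix.mul_assoc, Matrix.smul_apply, Matrix.one_apply_eq, smul_eq_mul, mul_one] at this
      exact this

end RankNumericalRange

theorem infinite_unit_circle : {w : ℂ | ‖w‖ = 1}.Infinite := by
  have h : (Metric.sphere (0 : ℂ) 1).Infinite := by
    refine IsPreconnected.infinite_of_nontrivial ?_ ⟨1, by simp, -1, by simp, by norm_num⟩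
    exact (isConnected_sphere (by simp [Complex.rank_real_complex]) _ zero_le_one).isPreconnected
  exact h.mono fun a ha => by simpa using ha

theorem mul_star_eq_one_of_norm_eq_one {w : ℂ} (hw : ‖w‖ = 1) : w * star w = 1 := by
  have := Complex.mul_conj w
  rw [Complex.normSq_eq_norm_sq, hw] at this
  simpa using this

/-! ### Isotropic subspaces from the cosquare B^{-*}B. -/

section Cosquare

open scoped ComplexOrder

open Module.End

variable {m : Type*} [Fintype m]

/-- Expanding the invariance with Tx = ax + x' and Ty = by + y' leaves (ā b - 1) times the form,
plus terms in which some vector has lower order. Induction on the total order removes these. -/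
theorem form_eq_zero_of_generalizedEigenvectors {B : Matrix m m ℂ} {T : Module.End ℂ (m → ℂ)}
    (hT : ∀ x y, star (T x) ⬝ᵥ (B *ᵥ T y) = star x ⬝ᵥ (B *ᵥ y)) {a b : ℂ} (hab : star a * b ≠ 1)
    (N : ℕ) : ∀ i j : ℕ, i + j ≤ N → ∀ x y, ((T - a • 1) ^ i) x = 0 → ((T - b • 1) ^ j) y = 0 →
      star x ⬝ᵥ (B *ᵥ y) = 0 := by
  induction N with
  | zero =>
    intro i j hij x y hx hy
    obtain rfl : i = 0 := by omega
    have : x = 0 := by simpa using hx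
    simp [this]
  | succ N ih =>
    intro i j hij x y hx hy
    rcases i with _ | i
    · have : x = 0 := by simpa using hx
      simp [this]
    rcases j with _ | j
    · have : y = 0 := by simpa using hy
      simp [this]
    have hx' : ((T - a • 1) ^ i) ((T - a • 1) x) = 0 := by
      rw [← Module.End.mul_apply, ← pow_succ]; exact hx
    have hy' : ((T - b • 1) ^ j) ((T - b • 1) y) = 0 := by
      rw [← Module.End.mul_apply, ← pow_succ]; exact hy
    have h1 := ih i (j + 1) (by omega) _ _ hx' hy
    have h2 := ih (i + 1) j (by omega) _ _ hx hy'
    have h3 := ih i j (by omega) _ _ hx' hy'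
    have h := hT x y
    have ex : T x = a • x + (T - a • 1) x := by simp
    have ey : T y = b • y + (T - b • 1) y := by simp
    rw [ex, ey] at h
    simp only [star_add, star_smul, Matrix.mulVec_add, Matrix.mulVec_smul, add_dotProduct,
      dotProduct_add, smul_dotProduct, dotProduct_smul, h1, h2, h3, smul_eq_mul] at h
    have : (star a * b - 1) * (star x ⬝ᵥ (B *ᵥ y)) = 0 := by linear_combination h
    exact (mul_eq_zero.mp this).resolve_left (sub_ne_zero.mpr hab)

/-- The sum of the generalized eigenspaces of `T` at the eigenvalues satisfying `p`. -/
noncomputable def spectralSubspace (T : Module.End ℂ (m → ℂ)) (p : ℂ → Prop) :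
    Submodule ℂ (m → ℂ) :=
  ⨆ a : {a // p a}, T.maxGenEigenspace a

theorem form_eq_zero_of_mem_spectralSubspace {B : Matrix m m ℂ} {T : Module.End ℂ (m → ℂ)}
    (hT : ∀ x y, star (T x) ⬝ᵥ (B *ᵥ T y) = star x ⬝ᵥ (B *ᵥ y)) {p : ℂ → Prop}
    (hp : ∀ a b, p a → p b → star a * b ≠ 1) {x y : m → ℂ}
    (hx : x ∈ spectralSubspace T p) (hy : y ∈ spectralSubspace T p) :
    star x ⬝ᵥ (B *ᵥ y) = 0 := by
  refine Submodule.iSup_induction (motive := fun x => star x ⬝ᵥ (B *ᵥ y) = 0) _ hx ?_ (by simp) ?_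
  · intro a x hx
    refine Submodule.iSup_induction (motive := fun y => star x ⬝ᵥ (B *ᵥ y) = 0) _ hy ?_ (by simp) ?_
    · intro b y hy
      obtain ⟨i, hi⟩ := (mem_maxGenEigenspace T _ _).mp hx
      obtain ⟨j, hj⟩ := (mem_maxGenEigenspace T _ _).mp hy
      exact form_eq_zero_of_generalizedEigenvectors hT (hp a b a.2 b.2) (i + j) i j le_rfl x y hi hj
    · intro y y' h h'
      rw [Matrix.mulVec_add, dotProduct_add, h, h', add_zero]
  · intro x x' h h'
    rw [star_add, add_dotProduct, h, h', add_zero]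

theorem finrank_biSup_le {ι V : Type*} [AddCommGroup V] [Module ℂ V] [FiniteDimensional ℂ V]
    (t : Finset ι) (f : ι → Submodule ℂ V) :
    Module.finrank ℂ (⨆ i ∈ t, f i : Submodule ℂ V) ≤ ∑ i ∈ t, Module.finrank ℂ (f i) := by
  classical
  induction t using Finset.induction_on with
  | empty => simp
  | insert a t ha ih =>
    rw [Finset.iSup_insert, Finset.sum_insert ha]
    exact (Submodule.finrank_add_le_finrank_add_finrank _ _).trans (by omega)

theorem finrank_spectralSubspace_le (T : Module.End ℂ (m → ℂ)) (p : ℂ → Prop) [DecidablePred p] :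
    Module.finrank ℂ (spectralSubspace T p) ≤ (T.charpoly.roots.filter p).card := by
  classical
  have h0 : T.charpoly ≠ 0 := T.charpoly_monic.ne_zero
  have h1 : spectralSubspace T p ≤
      ⨆ a ∈ (T.charpoly.roots.filter p).toFinset, T.maxGenEigenspace a := by
    refine iSup_le fun a => ?_
    by_cases ha : (a : ℂ) ∈ T.charpoly.roots
    · exact le_iSup₂_of_le (a : ℂ) (by simpa using ⟨by simpa using ha, a.2⟩) le_rfl
    · have : Module.finrank ℂ (T.maxGenEigenspace (a : ℂ)) = 0 := by
        rw [LinearMap.finrank_maxGenEigenspace_eq, ← Polynomial.count_roots]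
        exact Multiset.count_eq_zero.mpr ha
      rw [Submodule.finrank_eq_zero.mp this]
      exact bot_le
  refine (Submodule.finrank_mono h1).trans ((finrank_biSup_le _ _).trans ?_)
  rw [← Multiset.toFinset_sum_count_eq]
  refine Finset.sum_le_sum fun a ha => ?_
  rw [LinearMap.finrank_maxGenEigenspace_eq, ← Polynomial.count_roots, Multiset.count_filter,
    if_pos (by simpa using (Multiset.mem_filter.mp (Multiset.mem_toFinset.mp ha)).2)]

/-- Two eigenvalues both inside, or both outside, the unit circle never satisfy ā b = 1, so both
spectral subspaces are isotropic. Their dimensions add up to at least 2k. -/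
theorem exists_isotropic_of_preserves {B : Matrix m m ℂ} {T : Module.End ℂ (m → ℂ)}
    (hT : ∀ x y, star (T x) ⬝ᵥ (B *ᵥ T y) = star x ⬝ᵥ (B *ᵥ y)) {k : ℕ}
    (hk : (T.charpoly.roots.filter (fun a => ‖a‖ = 1)).card + 2 * k ≤ Fintype.card m) :
    ∃ S : Submodule ℂ (m → ℂ), k ≤ Module.finrank ℂ S ∧
      ∀ x ∈ S, ∀ y ∈ S, star x ⬝ᵥ (B *ᵥ y) = 0 := by
  classical
  let S₁ := spectralSubspace T (fun a => ‖a‖ < 1)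
  let S₂ := spectralSubspace T (fun a => 1 < ‖a‖)
  let S₀ := spectralSubspace T (fun a => ‖a‖ = 1)
  have htop : (⊤ : Submodule ℂ (m → ℂ)) ≤ S₁ ⊔ S₂ ⊔ S₀ := by
    rw [← iSup_maxGenEigenspace_eq_top T]
    refine iSup_le fun a => ?_
    rcases lt_trichotomy ‖a‖ 1 with h | h | h
    · exact (le_iSup (fun a : {a : ℂ // ‖a‖ < 1} => T.maxGenEigenspace a) ⟨a, h⟩).trans
        (le_sup_left.trans le_sup_left)
    · exact (le_iSup (fun a : {a : ℂ // ‖a‖ = 1} => T.maxGenEigenspace a) ⟨a, h⟩).trans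
        le_sup_right
    · exact (le_iSup (fun a : {a : ℂ // 1 < ‖a‖} => T.maxGenEigenspace a) ⟨a, h⟩).trans
        (le_sup_right.trans le_sup_left)
  have hdim : Fintype.card m ≤
      Module.finrank ℂ S₁ + Module.finrank ℂ S₂ + Module.finrank ℂ S₀ := by
    have h := Submodule.finrank_mono htop
    rw [finrank_top, Module.finrank_fintype_fun_eq_card] at h
    have h1 := Submodule.finrank_add_le_finrank_add_finrank (S₁ ⊔ S₂) S₀
    have h2 := Submodule.finrank_add_le_finrank_add_finrank S₁ S₂
    omega
  have h0 : Module.finrank ℂ S₀ ≤ _ := finrank_spectralSubspace_le T (fun a => ‖a‖ = 1)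
  have hnorm : ∀ a b : ℂ, star a * b = 1 → ‖a‖ * ‖b‖ = 1 := by
    intro a b h
    have := congrArg norm h
    simpa using this
  rcases le_or_gt k (Module.finrank ℂ S₁) with h | h
  · refine ⟨S₁, h, fun x hx y hy => form_eq_zero_of_mem_spectralSubspace hT ?_ hx hy⟩
    intro a b ha hb hab
    have := hnorm a b hab
    nlinarith [norm_nonneg a, norm_nonneg b]
  · refine ⟨S₂, by omega, fun x hx y hy => form_eq_zero_of_mem_spectralSubspace hT ?_ hx hy⟩
    intro a b ha hb hab
    have := hnorm a b hab
    nlinarith [norm_nonneg a, norm_nonneg b]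

variable [DecidableEq m]

theorem det_sub_smul_conjTranspose {B : Matrix m m ℂ} (hB : B.det ≠ 0) (a : ℂ) :
    (B - a • Bᴴ).det = Bᴴ.det * (-1) ^ Fintype.card m * ((Bᴴ)⁻¹ * B).charpoly.eval a := by
  have hu : IsUnit Bᴴ.det := by
    rw [Matrix.det_conjTranspose]; exact (isUnit_iff_ne_zero.mpr (by simpa using hB))
  rw [Matrix.eval_charpoly, mul_assoc, ← Matrix.det_neg, ← Matrix.det_mul]
  congr 1
  rw [neg_sub, Matrix.mul_sub, Matrix.mul_nonsing_inv_cancel_left _ _ hu, Matrix.scalar_apply,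
    ← Matrix.smul_one_eq_diagonal, Matrix.mul_smul, Matrix.mul_one]

theorem exists_isotropic_of_card_unimodular_roots {B : Matrix m m ℂ} (hB : B.det ≠ 0) {k : ℕ}
    (hk : (((Bᴴ)⁻¹ * B).charpoly.roots.filter (fun a => ‖a‖ = 1)).card + 2 * k ≤
      Fintype.card m) :
    ∃ S : Submodule ℂ (m → ℂ), k ≤ Module.finrank ℂ S ∧
      ∀ x ∈ S, ∀ y ∈ S, star x ⬝ᵥ (B *ᵥ y) = 0 := by
  refine exists_isotropic_of_preserves (T := Matrix.toLin' ((Bᴴ)⁻¹ * B)) ?_ ?_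
  · intro x y
    have hu : IsUnit B.det := isUnit_iff_ne_zero.mpr hB
    have hu' : IsUnit Bᴴ.det := by
      rw [Matrix.det_conjTranspose]; exact hu.star
    have h : ((Bᴴ)⁻¹ * B)ᴴ * B * ((Bᴴ)⁻¹ * B) = B := by
      rw [Matrix.conjTranspose_mul, Matrix.conjTranspose_nonsing_inv,
        Matrix.conjTranspose_conjTranspose, Matrix.mul_assoc Bᴴ, Matrix.nonsing_inv_mul _ hu,
        Matrix.mul_one, Matrix.mul_nonsing_inv_cancel_left _ _ hu']
    rw [Matrix.toLin'_apply, Matrix.toLin'_apply, Matrix.star_mulVec, Matrix.mulVec_mulVec,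
      ← Matrix.dotProduct_mulVec, Matrix.mulVec_mulVec, ← Matrix.mul_assoc, h]
  · rwa [Matrix.charpoly_toLin']

/-- If, on the unit circle, `det (B - a B*)` is the product of a polynomial of degree at most
`card m - 2 k` and a polynomial without unimodular roots, then the form of `B` has an isotropic
subspace of dimension `k`. -/
theorem exists_isotropic_of_det_eq {B : Matrix m m ℂ} (hB : B.det ≠ 0) {k : ℕ}
    (R Q : Polynomial ℂ) (hR : R.natDegree + 2 * k ≤ Fintype.card m)
    (hQ : ∀ a : ℂ, ‖a‖ = 1 → Q.eval a ≠ 0)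
    (hdet : ∀ a : ℂ, ‖a‖ = 1 → (B - a • Bᴴ).det = R.eval a * Q.eval a) :
    ∃ S : Submodule ℂ (m → ℂ), k ≤ Module.finrank ℂ S ∧
      ∀ x ∈ S, ∀ y ∈ S, star x ⬝ᵥ (B *ᵥ y) = 0 := by
  refine exists_isotropic_of_card_unimodular_roots hB ?_
  have hB' : Bᴴ.det ≠ 0 := by simpa [Matrix.det_conjTranspose] using hB
  set χ := ((Bᴴ)⁻¹ * B).charpoly with hχ
  have hc : Bᴴ.det * (-1) ^ Fintype.card m ≠ 0 :=
    mul_ne_zero hB' (pow_ne_zero _ (by norm_num))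
  -- The unit circle is infinite, so the factorization known there is an identity of polynomials and
  -- hence of root multisets.
  have heq : Polynomial.C (Bᴴ.det * (-1) ^ Fintype.card m) * χ = R * Q := by
    refine Polynomial.eq_of_infinite_eval_eq _ _ (infinite_unit_circle.mono fun a ha => ?_)
    have ha' : ‖a‖ = 1 := ha
    simp only [Set.mem_ofPred_eq, Polynomial.eval_mul, Polynomial.eval_C]
    rw [← hdet a ha', det_sub_smul_conjTranspose hB]
  have hne : R * Q ≠ 0 := by
    rw [← heq]
    exact mul_ne_zero (Polynomial.C_ne_zero.mpr hc) (Matrix.charpoly_monic _).ne_zero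
  have hroots : χ.roots = R.roots + Q.roots := by
    rw [← Polynomial.roots_mul hne, ← heq, Polynomial.roots_C_mul _ hc]
  have hQ' : Q.roots.filter (fun a => ‖a‖ = 1) = 0 := by
    rw [Multiset.filter_eq_nil]
    intro a ha h
    exact hQ a h (Polynomial.isRoot_of_mem_roots ha)
  rw [hroots, Multiset.filter_add, hQ', add_zero]
  have h1 := Multiset.card_le_card (Multiset.filter_le (fun a => ‖a‖ = 1) R.roots)
  have h2 := Polynomial.card_roots' R
  omega

/-- B may be singular, so B' = B + cB* is used with c slightly below 1; it is invertible because B +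
B* is (take a = -1). The map a ↦ (a - c)/(1 - ac) preserves the unit circle, so the determinant
condition passes to B'. Since c² ≠ 1, B is a combination of B' and B'*, and isotropy passes back. -/
theorem exists_isotropic_of_det_ne_zero {B : Matrix m m ℂ} {k : ℕ} (hk : 2 * k ≤ Fintype.card m)
    (hdet : ∀ a : ℂ, ‖a‖ = 1 → (B - a • Bᴴ).det ≠ 0) :
    ∃ S : Submodule ℂ (m → ℂ), k ≤ Module.finrank ℂ S ∧
      ∀ x ∈ S, ∀ y ∈ S, star x ⬝ᵥ (B *ᵥ y) = 0 := by
  obtain ⟨c, hc0, hc1, hc⟩ : ∃ c : ℝ, 0 < c ∧ c < 1 ∧ (B + (c : ℂ) • Bᴴ).det ≠ 0 := by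
    have hcont : Continuous fun c : ℝ => (B + (c : ℂ) • Bᴴ).det := by fun_prop
    have h1 : (B + ((1 : ℝ) : ℂ) • Bᴴ).det ≠ 0 := by
      have := hdet (-1) (by simp)
      simpa using this
    have hev := (hcont.continuousAt.eventually_ne h1)
    obtain ⟨ε, hε, hball⟩ := Metric.eventually_nhds_iff.mp hev
    refine ⟨1 - min ε 1 / 2, ?_, ?_, hball ?_⟩
    · have := min_le_right ε 1; linarith
    · have := lt_min hε one_pos; linarith
    · have h2 := min_le_left ε 1
      have h3 := lt_min hε one_pos
      rw [Real.dist_eq, abs_lt]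
      constructor <;> linarith
  set B' := B + (c : ℂ) • Bᴴ with hB'
  have hB'H : B'ᴴ = Bᴴ + (c : ℂ) • B := by
    simp [hB', Matrix.conjTranspose_add, Matrix.conjTranspose_smul]
  have hdet' : ∀ a : ℂ, ‖a‖ = 1 → (B' - a • B'ᴴ).det ≠ 0 := by
    intro a ha
    have h1 : 1 - a * c ≠ 0 := by
      intro h
      have : ‖a * (c : ℂ)‖ = 1 := by rw [← sub_eq_zero.mp h, norm_one]
      rw [norm_mul, ha, one_mul, Complex.norm_real, Real.norm_eq_abs, abs_of_pos hc0] at this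
      linarith
    have h2 : ‖(a - c) / (1 - a * c)‖ = 1 := by
      have haa := mul_star_eq_one_of_norm_eq_one ha
      have : a - c = a * star (1 - a * c) := by
        simp only [star_sub, star_one, star_mul', Complex.star_def, Complex.conj_ofReal] at haa ⊢
        linear_combination (c : ℂ) * haa
      rw [norm_div, this, norm_mul, norm_star, ha, one_mul, div_self (norm_ne_zero_iff.mpr h1)]
    have h3 : B' - a • B'ᴴ = (1 - a * c) • (B - ((a - c) / (1 - a * c)) • Bᴴ) := by
      rw [smul_sub, smul_smul, mul_div_cancel₀ _ h1, hB'H, hB']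
      module
    rw [h3, Matrix.det_smul]
    exact mul_ne_zero (pow_ne_zero _ h1) (hdet _ h2)
  obtain ⟨S, hS, h⟩ := exists_isotropic_of_card_unimodular_roots (B := B') (k := k) hc (by
    rw [Multiset.filter_eq_nil.mpr]
    · simpa using hk
    · intro a ha h1
      refine hdet' a h1 ?_
      rw [det_sub_smul_conjTranspose hc, Polynomial.isRoot_of_mem_roots ha, mul_zero])
  refine ⟨S, hS, fun x hx y hy => ?_⟩
  have h1 := h x hx y hy
  have h2 := congrArg star (h y hy x hx)
  have h3 : star (star y ⬝ᵥ (B' *ᵥ x)) = star x ⬝ᵥ (B'ᴴ *ᵥ y) := by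
    rw [Matrix.star_dotProduct, Matrix.star_mulVec, Matrix.dotProduct_mulVec]
    simp
  rw [h3, hB'H, star_zero] at h2
  rw [hB'] at h1
  rw [Matrix.add_mulVec, Matrix.smul_mulVec, dotProduct_add, dotProduct_smul, smul_eq_mul] at h1 h2
  have hc2 : (1 - (c : ℂ) ^ 2) ≠ 0 := by
    have : (1 - c ^ 2 : ℝ) ≠ 0 := by nlinarith
    exact_mod_cast this
  have : (1 - (c : ℂ) ^ 2) * (star x ⬝ᵥ (B *ᵥ y)) = 0 := by linear_combination h1 - c * h2
  exact (mul_eq_zero.mp this).resolve_left hc2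

end Cosquare

/-! ### From constant spectrum to constant characteristic polynomial. -/

section Spectrum

open scoped ComplexOrder

/-- The value of the characteristic polynomial at a point is a product over eigenvalues from one
fixed finite set, so it takes finitely many values. Being continuous on an interval, it is constant;
thus the multiplicities are constant too. -/
theorem SpectrumIndependent.charpoly_eq {m : Type*} [Fintype m] [DecidableEq m]
    {M : ℝ → Matrix m m ℂ} (hM : SpectrumIndependent M) (hc : Continuous M)
    (hH : ∀ θ, (M θ).IsHermitian) {θ θ' : ℝ} (hθ : θ ∈ Set.Ico 0 (2 * Real.pi))
    (hθ' : θ' ∈ Set.Ico 0 (2 * Real.pi)) : (M θ).charpoly = (M θ').charpoly := by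
  refine Polynomial.funext fun x => ?_
  have hF : (spectrum ℂ (M θ)).Finite := by
    rw [(hH θ).spectrum_eq_image_range]
    exact (Set.finite_range _).image _
  let T : Set ℂ := (fun g : m → ℂ => ∏ i, (x - g i)) '' Set.pi Set.univ fun _ => spectrum ℂ (M θ)
  have hT : T.Finite := (Set.Finite.pi' fun _ => hF).image _ |>.subset (by
    rintro _ ⟨g, hg, rfl⟩
    exact ⟨g, fun i => hg i (Set.mem_univ i), rfl⟩)
  have hcont : Continuous fun θ => (M θ).charpoly.eval x := by
    simp only [Matrix.eval_charpoly]
    fun_prop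
  refine isPreconnected_Ico.constant_of_mapsTo (T := T) hT.isDiscrete hcont.continuousOn ?_ hθ hθ'
  intro φ hφ
  refine ⟨fun i => ((hH φ).eigenvalues i : ℂ), fun i _ => ?_, ?_⟩
  · rw [hM θ hθ φ hφ, (hH φ).spectrum_eq_image_range]
    exact ⟨_, ⟨i, rfl⟩, rfl⟩
  · simp only [(hH φ).charpoly_eq, Polynomial.eval_prod, Polynomial.eval_sub, Polynomial.eval_X,
      Polynomial.eval_C]
    rfl

theorem ListsNonzeroEigenvalues.charpoly_eq {m : Type*} [Fintype m] [DecidableEq m]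
    {X : Matrix m m ℂ} {p : ℕ} {μ : Fin p → ℝ} (h : ListsNonzeroEigenvalues X μ) :
    ∃ q : ℕ, p + q = Fintype.card m ∧
      X.charpoly = (∏ j, (Polynomial.X - Polynomial.C (μ j : ℂ))) * Polynomial.X ^ q := by
  obtain ⟨-, -, q, hq⟩ := h
  have hs := IsAlgClosed.splits X.charpoly
  refine ⟨q, ?_, ?_⟩
  · have h1 := hs.natDegree_eq_card_roots
    rw [Matrix.charpoly_natDegree_eq_dim, hq] at h1
    simpa using h1.symm
  · rw [hs.eq_prod_roots_of_monic X.charpoly_monic, hq, Multiset.map_add, Multiset.prod_add,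
      Multiset.map_map, Multiset.map_replicate, Multiset.prod_replicate, map_zero, sub_zero]
    rfl

end Spectrum

/-! ### The pencil C + wD* and the determinant of B - lB*. -/

section Pencil

open scoped ComplexOrder

variable {r s : ℕ}

theorem blockM_eq (C : Matrix (Fin r) (Fin s) ℂ) (D : Matrix (Fin s) (Fin r) ℂ) (θ : ℝ) :
    blockM C D θ = (C + Complex.exp (2 * Complex.I * θ) • Dᴴ)ᴴ *
      (C + Complex.exp (2 * Complex.I * θ) • Dᴴ) := by
  have h1 : star (Complex.exp (2 * Complex.I * θ)) = Complex.exp (-2 * Complex.I * θ) := by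
    rw [Complex.star_def, ← Complex.exp_conj]
    simp [Complex.conj_ofNat]
  have h2 : Complex.exp (-2 * Complex.I * θ) * Complex.exp (2 * Complex.I * θ) = 1 := by
    rw [← Complex.exp_add]
    simp
  have h3 : star (Complex.exp (-2 * Complex.I * θ)) = Complex.exp (2 * Complex.I * θ) := by
    rw [← h1, star_star]
  simp only [blockM, matRe, Matrix.conjTranspose_add, Matrix.conjTranspose_smul, h1, h3,
    Matrix.conjTranspose_conjTranspose, Matrix.conjTranspose_mul, Matrix.add_mul, Matrix.mul_add,
    Matrix.smul_mul, Matrix.mul_smul, smul_smul, smul_add]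
  rw [mul_comm (Complex.exp (2 * Complex.I * θ)) (Complex.exp (-2 * Complex.I * θ)), h2, one_smul]
  have h4 : ∀ z : ℂ, 2 * (1 / 2 * z) = z := fun z => by ring
  rw [h4, h4]
  abel

/-- The nonzero eigenvalues of `(C + w D*)* (C + w D*)` are the `μ j`, for all unimodular `w`. -/
structure ConstantSpectrum (C : Matrix (Fin r) (Fin s) ℂ) (D : Matrix (Fin s) (Fin r) ℂ)
    {p : ℕ} (μ : Fin p → ℝ) (q : ℕ) : Prop where
  anti : Antitone μ
  ne_zero : ∀ j, μ j ≠ 0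
  card : p + q = s
  charpoly_eq : ∀ w : ℂ, ‖w‖ = 1 → ((C + w • Dᴴ)ᴴ * (C + w • Dᴴ)).charpoly =
    (∏ j, (Polynomial.X - Polynomial.C (μ j : ℂ))) * Polynomial.X ^ q

theorem exists_constantSpectrum {C : Matrix (Fin r) (Fin s) ℂ} {D : Matrix (Fin s) (Fin r) ℂ}
    {p : ℕ} {μ : Fin p → ℝ} (h1 : SpectrumIndependent (blockM C D))
    (h2 : ListsNonzeroEigenvalues (blockM C D 0) μ) : ∃ q, ConstantSpectrum C D μ q := by
  obtain ⟨q, hq, hχ⟩ := h2.charpoly_eq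
  refine ⟨q, h2.1, h2.2.1, by simpa using hq, fun w hw => ?_⟩
  have hH : ∀ θ, (blockM C D θ).IsHermitian := fun θ => by
    rw [blockM_eq]; exact Matrix.isHermitian_conjTranspose_mul_self _
  have hc : Continuous (blockM C D) := by
    unfold blockM matRe
    fun_prop
  -- Half the argument, reduced modulo 2π into the interval of the hypothesis; the reduction does
  -- not change e^{2iφ}.
  let φ := toIcoMod Real.two_pi_pos 0 (Complex.arg w / 2)
  have hφ : φ ∈ Set.Ico 0 (2 * Real.pi) := by
    simpa using toIcoMod_mem_Ico Real.two_pi_pos 0 (Complex.arg w / 2)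
  have hexp : Complex.exp (2 * Complex.I * φ) = w := by
    have h3 : φ = Complex.arg w / 2 -
        toIcoDiv Real.two_pi_pos 0 (Complex.arg w / 2) • (2 * Real.pi) := rfl
    have h4 : (2 * Complex.I * φ : ℂ) = Complex.arg w * Complex.I -
        ((2 * toIcoDiv Real.two_pi_pos 0 (Complex.arg w / 2) : ℤ) : ℂ) *
          (2 * Real.pi * Complex.I) := by
      rw [h3]; push_cast [zsmul_eq_mul]; ring
    rw [h4, Complex.exp_sub, Complex.exp_int_mul_two_pi_mul_I, div_one]
    have := Complex.norm_mul_exp_arg_mul_I w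
    rwa [hw, Complex.ofReal_one, one_mul] at this
  rw [← hχ, ← h1.charpoly_eq hc hH hφ ⟨le_rfl, Real.two_pi_pos⟩, blockM_eq, hexp]

/-- Schur complement for x ≠ 0, then continuity in x. -/
theorem det_fromBlocks_smul_one (h : s ≤ r) (x y : ℂ) (P : Matrix (Fin r) (Fin s) ℂ)
    (Q : Matrix (Fin s) (Fin r) ℂ) :
    (Matrix.fromBlocks (x • 1) P Q (y • 1)).det =
      x ^ (r - s) * ((x * y) • (1 : Matrix (Fin s) (Fin s) ℂ) - Q * P).det := by
  revert x
  have hl : Continuous fun x : ℂ => (Matrix.fromBlocks (x • 1) P Q (y • 1)).det := by fun_prop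
  have hr : Continuous fun x : ℂ =>
      x ^ (r - s) * ((x * y) • (1 : Matrix (Fin s) (Fin s) ℂ) - Q * P).det := by fun_prop
  refine fun x => congrFun (hl.ext_on (dense_compl_singleton (0 : ℂ)) hr fun x hx => ?_) x
  have hx : x ≠ 0 := hx
  let _ : Invertible (x • (1 : Matrix (Fin r) (Fin r) ℂ)) :=
    ⟨x⁻¹ • 1, by simp [smul_smul, hx], by simp [smul_smul, hx]⟩
  have hinv : ⅟(x • (1 : Matrix (Fin r) (Fin r) ℂ)) = x⁻¹ • 1 := rfl
  simp only
  rw [Matrix.det_fromBlocks₁₁, hinv, Matrix.det_smul, Matrix.det_one, mul_one, Fintype.card_fin]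
  have h1 : (x * y) • (1 : Matrix (Fin s) (Fin s) ℂ) - Q * P =
      x • (y • (1 : Matrix (Fin s) (Fin s) ℂ) - Q * (x⁻¹ • (1 : Matrix (Fin r) (Fin r) ℂ)) * P) := by
    simp [smul_sub, smul_smul, hx]
  rw [h1, Matrix.det_smul, Fintype.card_fin, ← mul_assoc, ← pow_add, Nat.sub_add_cancel h]

theorem smul_conjTranspose_add_smul (C : Matrix (Fin r) (Fin s) ℂ)
    (D : Matrix (Fin s) (Fin r) ℂ) {w : ℂ} (hw : ‖w‖ = 1) :
    w • (C + w • Dᴴ)ᴴ = D + w • Cᴴ := by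
  rw [Matrix.conjTranspose_add, Matrix.conjTranspose_smul, Matrix.conjTranspose_conjTranspose,
    smul_add, smul_smul, mul_star_eq_one_of_norm_eq_one hw, one_smul, add_comm]

/-- For unimodular w, D + wC* = w(C + wD*)*, so the left side is w^s times the known characteristic
polynomial at t w̄. Both sides are polynomials in w, so they agree everywhere; the value w = 0 later
gives det B. -/
theorem ConstantSpectrum.det_smul_one_sub {C : Matrix (Fin r) (Fin s) ℂ}
    {D : Matrix (Fin s) (Fin r) ℂ} {p q : ℕ} {μ : Fin p → ℝ} (h : ConstantSpectrum C D μ q)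
    (t w : ℂ) :
    (t • (1 : Matrix (Fin s) (Fin s) ℂ) - (D + w • Cᴴ) * (C + w • Dᴴ)).det =
      (∏ j, (t - w * μ j)) * t ^ q := by
  let L : Matrix (Fin s) (Fin s) (Polynomial ℂ) :=
    (t • (1 : Matrix (Fin s) (Fin s) ℂ)).map Polynomial.C -
      (D.map Polynomial.C + (Polynomial.X : Polynomial ℂ) • Cᴴ.map Polynomial.C) *
        (C.map Polynomial.C + (Polynomial.X : Polynomial ℂ) • Dᴴ.map Polynomial.C)
  let R : Polynomial ℂ :=
    (∏ j, (Polynomial.C t - Polynomial.X * Polynomial.C (μ j : ℂ))) * Polynomial.C t ^ q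
  have hL : ∀ w, L.det.eval w =
      (t • (1 : Matrix (Fin s) (Fin s) ℂ) - (D + w • Cᴴ) * (C + w • Dᴴ)).det := by
    intro w
    have := (Polynomial.evalRingHom w).map_det L
    rw [Polynomial.coe_evalRingHom] at this
    rw [this]
    congr 1
    ext i j
    simp [L, Matrix.mul_apply, Polynomial.eval_finsetSum, mul_comm w]
  have hR : ∀ w, R.eval w = (∏ j, (t - w * μ j)) * t ^ q := by
    intro w
    simp [R, Polynomial.eval_prod, mul_comm w]
  have heq : L.det = R := by
    refine Polynomial.eq_of_infinite_eval_eq _ _ (infinite_unit_circle.mono fun w hw => ?_)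
    have hw : ‖w‖ = 1 := hw
    have hw0 : w ≠ 0 := by rintro rfl; simp at hw
    have hww := mul_star_eq_one_of_norm_eq_one hw
    change L.det.eval w = R.eval w
    have h1 : t • (1 : Matrix (Fin s) (Fin s) ℂ) - (D + w • Cᴴ) * (C + w • Dᴴ) =
        w • ((t * star w) • (1 : Matrix (Fin s) (Fin s) ℂ) -
          (C + w • Dᴴ)ᴴ * (C + w • Dᴴ)) := by
      rw [smul_sub, smul_smul, ← Matrix.smul_mul, smul_conjTranspose_add_smul C D hw]
      congr 2
      linear_combination -t * hww
    have h3 := h.charpoly_eq w hw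
    have h4 := congrArg (Polynomial.eval (t * star w)) h3
    rw [Matrix.eval_charpoly, Matrix.scalar_apply, ← Matrix.smul_one_eq_diagonal] at h4
    rw [hL, hR, h1, Matrix.det_smul, h4, Fintype.card_fin]
    simp only [Polynomial.eval_mul, Polynomial.eval_prod, Polynomial.eval_sub, Polynomial.eval_X,
      Polynomial.eval_C, Polynomial.eval_pow]
    have h5 : w ^ s = (∏ _j : Fin p, w) * w ^ q := by
      rw [Finset.prod_const, Finset.card_univ, Fintype.card_fin, ← pow_add, h.card]
    rw [h5, mul_mul_mul_comm, ← Finset.prod_mul_distrib, ← mul_pow]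
    congr 1
    · refine Finset.prod_congr rfl fun j _ => ?_
      linear_combination t * hww
    · congr 1
      linear_combination t * hww
  rw [← hL, heq, hR]

theorem scalarDiagBlocks_sub_smul_conjTranspose (C : Matrix (Fin r) (Fin s) ℂ)
    (D : Matrix (Fin s) (Fin r) ℂ) (a b l : ℂ) :
    scalarDiagBlocks a b C D - l • (scalarDiagBlocks a b C D)ᴴ =
      Matrix.fromBlocks ((a - l * star a) • 1) (C + (-l) • Dᴴ) (D + (-l) • Cᴴ)
        ((b - l * star b) • 1) := by
  rw [scalarDiagBlocks, Matrix.fromBlocks_conjTranspose, Matrix.fromBlocks_smul,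
    sub_eq_add_neg, Matrix.fromBlocks_neg, Matrix.fromBlocks_add]
  congr 1
  · simp [smul_smul, ← sub_eq_add_neg, ← sub_smul]
  · simp
  · simp
  · simp [smul_smul, ← sub_eq_add_neg, ← sub_smul]

theorem ConstantSpectrum.det_scalarDiagBlocks_sub (hsr : s ≤ r) {C : Matrix (Fin r) (Fin s) ℂ}
    {D : Matrix (Fin s) (Fin r) ℂ} {p q : ℕ} {μ : Fin p → ℝ} (h : ConstantSpectrum C D μ q)
    (a b l : ℂ) :
    (scalarDiagBlocks a b C D - l • (scalarDiagBlocks a b C D)ᴴ).det =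
      (a - l * star a) ^ (r - s) *
        ((∏ j, ((a - l * star a) * (b - l * star b) + l * μ j)) *
          ((a - l * star a) * (b - l * star b)) ^ q) := by
  rw [scalarDiagBlocks_sub_smul_conjTranspose, det_fromBlocks_smul_one hsr, h.det_smul_one_sub]
  congr 2
  refine Finset.prod_congr rfl fun j _ => ?_
  ring

end Pencil

/-! ### The elliptical disc as an inequality without square roots. -/

section EllipticalDisc

open scoped ComplexOrder

theorem sq_norm_sub_add (a b : ℂ) :
    ‖a - b‖ ^ 2 + 2 * (‖a‖ * ‖b‖ + (a * star b).re) = (‖a‖ + ‖b‖) ^ 2 := by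
  have h1 := Complex.sq_norm (a - b)
  have h2 := Complex.sq_norm a
  have h3 := Complex.sq_norm b
  rw [Complex.normSq_apply] at h1 h2 h3
  simp only [Complex.sub_re, Complex.sub_im, Complex.mul_re, Complex.star_def, Complex.conj_re,
    Complex.conj_im] at h1 ⊢
  linear_combination h1 - h2 - h3

theorem mem_ellipticalDisc_iff (α β z : ℂ) (t : ℝ) :
    z ∈ ellipticalDisc α β t ↔
      2 * (‖α - z‖ * ‖β - z‖ + ((α - z) * star (β - z)).re) ≤ t ^ 2 := by
  have h := sq_norm_sub_add (α - z) (β - z)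
  rw [sub_sub_sub_cancel_right] at h
  rw [ellipticalDisc, Set.mem_ofPred_eq, norm_sub_rev z α, norm_sub_rev z β,
    Real.le_sqrt (by positivity) (by positivity), ← h]
  constructor <;> intro h' <;> linarith

theorem ellipticalDisc_zero (α β : ℂ) : ellipticalDisc α β 0 = segment ℝ α β := by
  ext z
  rw [mem_segment_iff_wbtw, ← dist_add_dist_eq_iff, ellipticalDisc, Set.mem_ofPred_eq]
  have h := dist_triangle α z β
  rw [dist_eq_norm, dist_eq_norm, dist_eq_norm] at h ⊢
  rw [norm_sub_rev z α]
  simp only [ne_eq, OfNat.ofNat_ne_zero, not_false_eq_true, zero_pow, add_zero, norm_nonneg,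
    Real.sqrt_sq]
  exact ⟨fun h' => le_antisymm h' h, fun h' => h'.le⟩

theorem ellipticalDisc_comm (α β : ℂ) (t : ℝ) : ellipticalDisc α β t = ellipticalDisc β α t := by
  ext z
  simp only [ellipticalDisc, Set.mem_ofPred_eq]
  rw [add_comm, norm_sub_rev α β]

theorem isOpen_setOf_mul_norm_lt (α β : ℂ) (c : ℝ) :
    IsOpen {z : ℂ | 2 * (‖α - z‖ * ‖β - z‖ + ((α - z) * star (β - z)).re) < c} :=
  isOpen_lt (by fun_prop) continuous_const

/-- At α the sum of the focal distances is |α - β|, strictly below the bound because t > 0. By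
convexity the inequality is strict along the segment from α to z, before z is reached. -/
theorem ellipticalDisc_subset_closure (α β : ℂ) {t : ℝ} (ht : 0 < t) :
    ellipticalDisc α β t ⊆
      closure {z | 2 * (‖α - z‖ * ‖β - z‖ + ((α - z) * star (β - z)).re) < t ^ 2} := by
  intro z hz
  set c := √(‖α - β‖ ^ 2 + t ^ 2) with hc
  have hαβ : ‖α - β‖ < c := Real.lt_sqrt_of_sq_lt (by nlinarith)
  have hz : ‖z - α‖ + ‖z - β‖ ≤ c := hz
  let f : ℝ → ℂ := fun u => (1 - u : ℝ) • α + u • z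
  have hf : Filter.Tendsto f (nhdsWithin 1 (Set.Iio 1)) (nhds z) := by
    have : Continuous f := by fun_prop
    have h1 := this.tendsto 1
    simp only [f, sub_self, zero_smul, one_smul, zero_add] at h1
    exact h1.mono_left nhdsWithin_le_nhds
  refine mem_closure_of_tendsto hf ?_
  have hev : ∀ᶠ u : ℝ in nhdsWithin 1 (Set.Iio 1), 0 < u ∧ u < 1 :=
    Filter.Eventually.and (nhdsWithin_le_nhds (Ioi_mem_nhds one_pos)) self_mem_nhdsWithin
  filter_upwards [hev] with u hu
  have h1 : ‖α - f u‖ = u * ‖z - α‖ := by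
    have : α - f u = (-u) • (z - α) := by simp only [f]; module
    rw [this, norm_smul, Real.norm_eq_abs, abs_neg, abs_of_pos hu.1]
  have h2 : ‖β - f u‖ ≤ (1 - u) * ‖α - β‖ + u * ‖z - β‖ := by
    have : β - f u = -((1 - u) • (α - β) + u • (z - β)) := by simp only [f]; module
    rw [this, norm_neg]
    refine (norm_add_le _ _).trans ?_
    rw [norm_smul, norm_smul, Real.norm_eq_abs, Real.norm_eq_abs, abs_of_pos hu.1,
      abs_of_pos (by linarith : 0 < 1 - u)]
  have h3 : ‖α - f u‖ + ‖β - f u‖ < c := by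
    nlinarith [mul_lt_mul_of_pos_left hαβ (by linarith : 0 < 1 - u),
      mul_le_mul_of_nonneg_left hz hu.1.le]
  have h := sq_norm_sub_add (α - f u) (β - f u)
  rw [sub_sub_sub_cancel_right] at h
  have h4 : (‖α - f u‖ + ‖β - f u‖) ^ 2 < ‖α - β‖ ^ 2 + t ^ 2 := by
    rw [← Real.lt_sqrt (by positivity)]; exact h3
  linarith

end EllipticalDisc

/-! ### The elliptical disc lies in the rank-`k` numerical range. -/

section Inclusion

open scoped ComplexOrder

variable {r s : ℕ}

theorem scalarDiagBlocks_sub_smul_one (α β z : ℂ) (C : Matrix (Fin r) (Fin s) ℂ)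
    (D : Matrix (Fin s) (Fin r) ℂ) :
    scalarDiagBlocks α β C D - z • 1 = scalarDiagBlocks (α - z) (β - z) C D := by
  rw [scalarDiagBlocks, scalarDiagBlocks, ← Matrix.fromBlocks_one, Matrix.fromBlocks_smul,
    sub_eq_add_neg, Matrix.fromBlocks_neg, Matrix.fromBlocks_add]
  simp [← sub_eq_add_neg, ← sub_smul]

theorem mem_rankNumRange_of_isotropic {m : Type*} [Fintype m] [DecidableEq m] {k : ℕ}
    {A : Matrix m m ℂ} {z : ℂ}
    (h : ∃ S : Submodule ℂ (m → ℂ), k ≤ Module.finrank ℂ S ∧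
      ∀ x ∈ S, ∀ y ∈ S, star x ⬝ᵥ ((A - z • 1) *ᵥ y) = 0) : z ∈ rankNumRange k A := by
  obtain ⟨S, hS, h⟩ := h
  refine mem_rankNumRange_of_subspace S hS fun x hx y hy => ?_
  have := h x hx y hy
  rwa [Matrix.sub_mulVec, Matrix.smul_mulVec, Matrix.one_mulVec, dotProduct_sub, dotProduct_smul,
    smul_eq_mul, sub_eq_zero] at this

/-- Dividing by l makes the quadratic real on the unit circle. It is bounded below there by
-2(|a||b| + Re(a b̄)), the negative of the expression that describes the ellipse. -/
theorem quadratic_eq_of_norm_eq_one (a b : ℂ) {l : ℂ} (hl : ‖l‖ = 1) :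
    (a - l * star a) * (b - l * star b) =
      l * ((2 * (star l * (a * b)).re - 2 * (a * star b).re : ℝ) : ℂ) := by
  have hll := mul_star_eq_one_of_norm_eq_one hl
  have e1 := Complex.add_conj (star l * (a * b))
  have e2 := Complex.add_conj (a * star b)
  simp only [Complex.star_def, map_mul, Complex.conj_conj] at e1 e2 hll ⊢
  push_cast at e1 e2 ⊢
  linear_combination l * e1 - l * e2 - a * b * hll

theorem neg_mul_norm_le_re {l : ℂ} (hl : ‖l‖ = 1) (a b : ℂ) :
    -(‖a‖ * ‖b‖) ≤ (star l * (a * b)).re := by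
  have h := Complex.abs_re_le_norm (star l * (a * b))
  rw [norm_mul, norm_star, hl, one_mul, norm_mul] at h
  exact (abs_le.mp h).1

theorem quadratic_ne_zero_of_norm_eq_one {a b l : ℂ} (hl : ‖l‖ = 1) {c : ℝ}
    (hc : 2 * (‖a‖ * ‖b‖ + (a * star b).re) < c) :
    (a - l * star a) * (b - l * star b) + l * c ≠ 0 := by
  have hl0 : l ≠ 0 := by rintro rfl; simp at hl
  rw [quadratic_eq_of_norm_eq_one a b hl, ← mul_add, ← Complex.ofReal_add]
  refine mul_ne_zero hl0 (Complex.ofReal_ne_zero.mpr (ne_of_gt ?_))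
  have := neg_mul_norm_le_re hl a b
  linarith

theorem ConstantSpectrum.mem_rankNumRange (hsr : s ≤ r) {C : Matrix (Fin r) (Fin s) ℂ}
    {D : Matrix (Fin s) (Fin r) ℂ} {p q : ℕ} {μ : Fin p → ℝ} (h : ConstantSpectrum C D μ q)
    (j : Fin p) {α β z : ℂ} (hα : z ≠ α) (hβ : z ≠ β)
    (hz : 2 * (‖α - z‖ * ‖β - z‖ + ((α - z) * star (β - z)).re) < μ j) :
    z ∈ rankNumRange ((j : ℕ) + 1) (scalarDiagBlocks α β C D) := by
  classical
  refine mem_rankNumRange_of_isotropic ?_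
  rw [scalarDiagBlocks_sub_smul_one]
  have ha : α - z ≠ 0 := sub_ne_zero.mpr hα.symm
  have hb : β - z ≠ 0 := sub_ne_zero.mpr hβ.symm
  set a := α - z
  set b := β - z
  let x : Polynomial ℂ := Polynomial.C a - Polynomial.X * Polynomial.C (star a)
  let y : Polynomial ℂ := Polynomial.C b - Polynomial.X * Polynomial.C (star b)
  let Q : Fin p → Polynomial ℂ := fun i => x * y + Polynomial.X * Polynomial.C (μ i : ℂ)
  have hx : x.natDegree ≤ 1 := by simp only [x]; compute_degree
  have hy : y.natDegree ≤ 1 := by simp only [y]; compute_degree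
  have hxy : (x * y).natDegree ≤ 2 := Polynomial.natDegree_mul_le_of_le hx hy
  have hQ : ∀ i, (Q i).natDegree ≤ 2 := fun i => by
    refine Polynomial.natDegree_add_le_of_degree_le hxy ?_
    compute_degree
    norm_num
  have hxe : ∀ l, x.eval l = a - l * star a := fun l => by simp [x, mul_comm l]
  have hye : ∀ l, y.eval l = b - l * star b := fun l => by simp [y, mul_comm l]
  have hQe : ∀ i l, (Q i).eval l = (a - l * star a) * (b - l * star b) + l * μ i := fun i l => by
    simp [Q, hxe, hye, mul_comm l]
  -- The factors with i ≤ j have μ_i ≥ μ_j, hence no unimodular zero. The others have total degree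
  -- at most (r - s) + 2(p - j - 1) + 2q = r + s - 2(j + 1), because p + q = s.
  refine exists_isotropic_of_det_eq ?_
    (x ^ (r - s) * ((∏ i ∈ Finset.univ.filter (fun i => ¬ i ≤ j), Q i) * (x * y) ^ q))
    (∏ i ∈ Finset.univ.filter (fun i => i ≤ j), Q i) ?_ ?_ ?_
  -- At l = 0 the formula gives det B as a product of powers of a and ab, nonzero because z is not a
  -- focus.
  · have h0 := h.det_scalarDiagBlocks_sub hsr a b 0
    simp only [zero_smul, sub_zero, zero_mul, add_zero] at h0
    rw [h0]
    have hab := mul_ne_zero ha hb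
    exact mul_ne_zero (pow_ne_zero _ ha)
      (mul_ne_zero (Finset.prod_ne_zero_iff.mpr fun _ _ => hab) (pow_ne_zero _ hab))
  · have hcard : (Finset.univ.filter (fun i : Fin p => ¬ i ≤ j)).card = p - (j + 1) := by
      simp only [not_le, Finset.filter_lt_eq_Ioi, Fin.card_Ioi]
      omega
    have d1 : (x ^ (r - s)).natDegree ≤ r - s := by
      simpa using Polynomial.natDegree_pow_le_of_le (r - s) hx
    have d2 : (∏ i ∈ Finset.univ.filter (fun i => ¬ i ≤ j), Q i).natDegree ≤
        (p - (j + 1)) * 2 := by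
      refine (Polynomial.natDegree_prod_le _ _).trans ?_
      rw [← hcard]
      exact Finset.sum_le_card_nsmul _ _ _ fun i _ => hQ i
    have d3 : ((x * y) ^ q).natDegree ≤ q * 2 := Polynomial.natDegree_pow_le_of_le q hxy
    have d4 := Polynomial.natDegree_mul_le_of_le d1 (Polynomial.natDegree_mul_le_of_le d2 d3)
    have := h.card
    have := j.2
    simp only [Fintype.card_sum, Fintype.card_fin]
    omega
  · intro l hl
    rw [Polynomial.eval_prod]
    refine Finset.prod_ne_zero_iff.mpr fun i hi => ?_
    rw [hQe]
    refine quadratic_ne_zero_of_norm_eq_one hl (hz.trans_le (h.anti ?_))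
    simpa using hi
  · intro l _
    rw [h.det_scalarDiagBlocks_sub hsr]
    simp only [Polynomial.eval_mul, Polynomial.eval_pow, Polynomial.eval_prod, hQe, hxe, hye]
    rw [← Finset.prod_filter_mul_prod_filter_not Finset.univ (fun i => i ≤ j)]
    ring

theorem ConstantSpectrum.ellipticalDisc_subset (hsr : s ≤ r) {C : Matrix (Fin r) (Fin s) ℂ}
    {D : Matrix (Fin s) (Fin r) ℂ} {p q : ℕ} {μ : Fin p → ℝ} (h : ConstantSpectrum C D μ q)
    (j : Fin p) (hj : 0 < μ j) (α β : ℂ) :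
    ellipticalDisc α β (√(μ j)) ⊆ rankNumRange ((j : ℕ) + 1) (scalarDiagBlocks α β C D) := by
  set U := {z : ℂ | 2 * (‖α - z‖ * ‖β - z‖ + ((α - z) * star (β - z)).re) < μ j}
  have hd : Dense ({α, β}ᶜ : Set ℂ) := by
    have := dense_univ.sdiff_finite (Set.toFinite ({α, β} : Set ℂ))
    rwa [← Set.compl_eq_univ_sdiff] at this
  have h1 := ellipticalDisc_subset_closure α β (Real.sqrt_pos.mpr hj)
  rw [Real.sq_sqrt hj.le] at h1
  refine h1.trans ?_
  refine (closure_mono (hd.open_subset_closure_inter (isOpen_setOf_mul_norm_lt α β (μ j)))).trans ?_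
  rw [closure_closure]
  refine closure_minimal ?_ (isClosed_rankNumRange _ _)
  rintro z ⟨hz, hz'⟩
  simp only [Set.mem_compl_iff, Set.mem_insert_iff, Set.mem_singleton_iff, not_or] at hz'
  exact h.mem_rankNumRange hsr j hz'.1 hz'.2 hz

end Inclusion

/-! ### Bounds for Hermitian forms. -/

section QuadraticForms

open scoped ComplexOrder

variable {m : Type*} [Fintype m]

theorem star_dotProduct_self_eq_ofReal (x : m → ℂ) :
    star x ⬝ᵥ x = ((∑ i, ‖x i‖ ^ 2 : ℝ) : ℂ) := by
  rw [dotProduct, Complex.ofReal_sum]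
  refine Finset.sum_congr rfl fun i _ => ?_
  rw [Pi.star_apply, mul_comm, Complex.star_def, Complex.mul_conj, Complex.normSq_eq_norm_sq]

theorem sum_norm_sq_eq_zero {x : m → ℂ} (h : ∑ i, ‖x i‖ ^ 2 = 0) : x = 0 := by
  funext i
  have := (Finset.sum_eq_zero_iff_of_nonneg (fun i _ => sq_nonneg ‖x i‖)).mp h i
    (Finset.mem_univ i)
  simpa using this

theorem norm_star_dotProduct_sq_le (x y : m → ℂ) :
    ‖star x ⬝ᵥ y‖ ^ 2 ≤ (∑ i, ‖x i‖ ^ 2) * ∑ i, ‖y i‖ ^ 2 := by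
  have h := norm_inner_le_norm (𝕜 := ℂ) (WithLp.toLp 2 x) (WithLp.toLp 2 y)
  rw [EuclideanSpace.inner_eq_star_dotProduct, dotProduct_comm] at h
  have h2 := pow_le_pow_left₀ (norm_nonneg _) h 2
  rwa [mul_pow, EuclideanSpace.norm_sq_eq, EuclideanSpace.norm_sq_eq] at h2

theorem star_dotProduct_conjTranspose_mul_self_mulVec {l : Type*} [Fintype l]
    (N : Matrix l m ℂ) (x : m → ℂ) :
    star x ⬝ᵥ ((Nᴴ * N) *ᵥ x) = star (N *ᵥ x) ⬝ᵥ (N *ᵥ x) := by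
  rw [Matrix.star_mulVec, ← Matrix.dotProduct_mulVec, Matrix.mulVec_mulVec]

variable [DecidableEq m]

/-- A Hermitian form is bounded by `c` on a subspace cut out by as many equations as there are
eigenvalues above `c`. -/
theorem Matrix.IsHermitian.exists_linearMap_form_le {A : Matrix m m ℂ} (hA : A.IsHermitian)
    (c : ℝ) :
    ∃ L : (m → ℂ) →ₗ[ℂ] ({i // c < hA.eigenvalues i} → ℂ), ∀ v, L v = 0 →
      (star v ⬝ᵥ (A *ᵥ v)).re ≤ c * ∑ i, ‖v i‖ ^ 2 := by
  let U : Matrix m m ℂ := hA.eigenvectorUnitary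
  have hU : U * Uᴴ = 1 := Unitary.coe_mul_star_self hA.eigenvectorUnitary
  refine ⟨LinearMap.funLeft ℂ ℂ Subtype.val ∘ₗ Uᴴ.mulVecLin, fun v hv => ?_⟩
  set y := Uᴴ *ᵥ v with hy
  have hy0 : ∀ i, c < hA.eigenvalues i → y i = 0 := fun i hi => congrFun hv ⟨i, hi⟩
  have h1 : star v ⬝ᵥ v = star y ⬝ᵥ y := by
    rw [hy, Matrix.star_mulVec, Matrix.conjTranspose_conjTranspose, ← Matrix.dotProduct_mulVec,
      Matrix.mulVec_mulVec, hU, Matrix.one_mulVec]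
  have h2 : star v ⬝ᵥ (A *ᵥ v) = ((∑ i, hA.eigenvalues i * ‖y i‖ ^ 2 : ℝ) : ℂ) := by
    have hsp := hA.spectral_theorem
    rw [Unitary.conjStarAlgAut_apply] at hsp
    have hsp' : A = U * Matrix.diagonal (RCLike.ofReal ∘ hA.eigenvalues) * Uᴴ := hsp
    calc star v ⬝ᵥ (A *ᵥ v)
        = star v ⬝ᵥ ((U * Matrix.diagonal (RCLike.ofReal ∘ hA.eigenvalues) * Uᴴ) *ᵥ v) := by
          rw [← hsp']
      _ = star y ⬝ᵥ (Matrix.diagonal (RCLike.ofReal ∘ hA.eigenvalues) *ᵥ y) := by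
          rw [hy, Matrix.star_mulVec, Matrix.conjTranspose_conjTranspose,
            ← Matrix.dotProduct_mulVec, Matrix.mulVec_mulVec, Matrix.mulVec_mulVec,
            Matrix.mul_assoc]
      _ = _ := by
          rw [dotProduct, Complex.ofReal_sum]
          refine Finset.sum_congr rfl fun i _ => ?_
          rw [Matrix.mulVec_diagonal, Pi.star_apply, Complex.ofReal_mul, Function.comp_apply,
            ← Complex.normSq_eq_norm_sq, ← Complex.mul_conj, Complex.star_def]
          simp only [Complex.coe_algebraMap]
          ring
  rw [star_dotProduct_self_eq_ofReal, star_dotProduct_self_eq_ofReal, Complex.ofReal_inj] at h1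
  rw [h2, Complex.ofReal_re, h1, Finset.mul_sum]
  refine Finset.sum_le_sum fun i _ => ?_
  by_cases hi : c < hA.eigenvalues i
  · simp [hy0 i hi]
  · exact mul_le_mul_of_nonneg_right (not_lt.mp hi) (sq_nonneg _)

end QuadraticForms

/-! ### The rank-`k` numerical range lies in the elliptical disc. -/

section Bounds

open scoped ComplexOrder

variable {r s : ℕ} {C : Matrix (Fin r) (Fin s) ℂ} {D : Matrix (Fin s) (Fin r) ℂ} {p q : ℕ}
  {μ : Fin p → ℝ}

theorem ConstantSpectrum.map_eigenvalues (h : ConstantSpectrum C D μ q) {w : ℂ} (hw : ‖w‖ = 1) :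
    Multiset.map (Matrix.isHermitian_conjTranspose_mul_self (C + w • Dᴴ)).eigenvalues
        Finset.univ.val =
      Multiset.map μ Finset.univ.val + Multiset.replicate q 0 := by
  have h1 := (Matrix.isHermitian_conjTranspose_mul_self
    (C + w • Dᴴ)).roots_charpoly_eq_eigenvalues
  have hprod : (∏ j, (Polynomial.X - Polynomial.C (μ j : ℂ))) ≠ 0 :=
    Finset.prod_ne_zero_iff.mpr fun j _ => Polynomial.X_sub_C_ne_zero _
  rw [h.charpoly_eq w hw, Polynomial.roots_mul
    (mul_ne_zero hprod (pow_ne_zero _ Polynomial.X_ne_zero)),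
    Polynomial.roots_pow, Polynomial.roots_X, Polynomial.roots_prod _ _ hprod] at h1
  have h2 := congrArg (Multiset.map Complex.re) h1
  simp only [Polynomial.roots_X_sub_C, Multiset.bind_singleton, Multiset.map_add,
    Multiset.map_map, Multiset.nsmul_singleton, Multiset.map_replicate, Complex.zero_re] at h2
  rw [← Function.comp_def, ← Function.comp_def] at h2
  exact h2.symm

theorem ConstantSpectrum.card_eigenvalues (h : ConstantSpectrum C D μ q) {w : ℂ} (hw : ‖w‖ = 1)
    (P : ℝ → Prop) [DecidablePred P] (hP : ¬ P 0) :
    Fintype.card {i // P ((Matrix.isHermitian_conjTranspose_mul_self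
      (C + w • Dᴴ)).eigenvalues i)} = (Finset.univ.filter fun j => P (μ j)).card := by
  have h1 := congrArg (Multiset.countP P) (h.map_eigenvalues hw)
  rw [Multiset.countP_add, Multiset.countP_map, Multiset.countP_map,
    (Multiset.countP_eq_zero (s := Multiset.replicate q (0 : ℝ))).mpr
      (fun a ha => by rwa [Multiset.eq_of_mem_replicate ha]), add_zero] at h1
  rw [Fintype.card_subtype]
  exact h1

theorem ConstantSpectrum.pos (h : ConstantSpectrum C D μ q) (j : Fin p) : 0 < μ j := by
  have h1 := h.map_eigenvalues (w := 1) (by simp)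
  have h2 : μ j ∈ Multiset.map μ Finset.univ.val + Multiset.replicate q 0 :=
    Multiset.mem_add.mpr (Or.inl (Multiset.mem_map_of_mem _ (Finset.mem_univ j)))
  rw [← h1, Multiset.mem_map] at h2
  obtain ⟨i, -, hi⟩ := h2
  refine lt_of_le_of_ne ?_ (h.ne_zero j).symm
  rw [← hi]
  exact (Matrix.posSemidef_conjTranspose_mul_self _).eigenvalues_nonneg i

theorem ConstantSpectrum.rank (h : ConstantSpectrum C D μ q) {w : ℂ} (hw : ‖w‖ = 1) :
    (C + w • Dᴴ).rank = p := by
  rw [← Matrix.rank_conjTranspose_mul_self,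
    (Matrix.isHermitian_conjTranspose_mul_self _).rank_eq_card_non_zero_eigs,
    h.card_eigenvalues hw (fun x => x ≠ 0) (by simp), Finset.filter_true_of_mem
      (fun j _ => h.ne_zero j), Finset.card_univ, Fintype.card_fin]

theorem scalarDiagBlocks_form (a b : ℂ) (C : Matrix (Fin r) (Fin s) ℂ)
    (D : Matrix (Fin s) (Fin r) ℂ) (x y : Fin r ⊕ Fin s → ℂ) :
    star x ⬝ᵥ (scalarDiagBlocks a b C D *ᵥ y) =
      a * (star (x ∘ Sum.inl) ⬝ᵥ (y ∘ Sum.inl)) +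
        star (x ∘ Sum.inl) ⬝ᵥ (C *ᵥ (y ∘ Sum.inr)) +
      (star (x ∘ Sum.inr) ⬝ᵥ (D *ᵥ (y ∘ Sum.inl)) +
        b * (star (x ∘ Sum.inr) ⬝ᵥ (y ∘ Sum.inr))) := by
  have hx : star x = Sum.elim (star (x ∘ Sum.inl)) (star (x ∘ Sum.inr)) := by
    ext (i | i) <;> rfl
  rw [scalarDiagBlocks, Matrix.fromBlocks_mulVec, hx, sumElim_dotProduct_sumElim,
    dotProduct_add, dotProduct_add, Matrix.smul_mulVec, Matrix.smul_mulVec, Matrix.one_mulVec,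
    Matrix.one_mulVec, dotProduct_smul, dotProduct_smul, smul_eq_mul, smul_eq_mul]

theorem star_dotProduct_mulVec_conj {m l : Type*} [Fintype m] [Fintype l] (N : Matrix m l ℂ)
    (x : m → ℂ) (y : l → ℂ) : star (star x ⬝ᵥ (N *ᵥ y)) = star y ⬝ᵥ (Nᴴ *ᵥ x) := by
  rw [Matrix.star_dotProduct, Matrix.star_mulVec, Matrix.dotProduct_mulVec, star_star]

theorem exists_subspace_isotropic_of_mem_rankNumRange {α β z : ℂ} {k : ℕ}
    (hz : z ∈ rankNumRange k (scalarDiagBlocks α β C D)) :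
    ∃ S : Submodule ℂ (Fin r ⊕ Fin s → ℂ), Module.finrank ℂ S = k ∧ ∀ x ∈ S, ∀ y ∈ S,
      star x ⬝ᵥ (scalarDiagBlocks (α - z) (β - z) C D *ᵥ y) = 0 := by
  obtain ⟨S, hS, h⟩ := exists_subspace_of_mem_rankNumRange hz
  refine ⟨S, hS, fun x hx y hy => ?_⟩
  rw [← scalarDiagBlocks_sub_smul_one, Matrix.sub_mulVec, Matrix.smul_mulVec, Matrix.one_mulVec,
    dotProduct_sub, dotProduct_smul, h x hx y hy, smul_eq_mul, sub_self]

theorem exists_mem_ne_zero_of_lt_finrank {V W : Type*} [AddCommGroup V] [Module ℂ V]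
    [FiniteDimensional ℂ V] [AddCommGroup W] [Module ℂ W] [FiniteDimensional ℂ W]
    (S : Submodule ℂ V) (L : V →ₗ[ℂ] W) (h : Module.finrank ℂ W < Module.finrank ℂ S) :
    ∃ x ∈ S, x ≠ 0 ∧ L x = 0 := by
  have h1 := LinearMap.ker_ne_bot_of_finrank_lt (f := L.domRestrict S) h
  obtain ⟨x, hx, hx0⟩ := (Submodule.ne_bot_iff _).mp h1
  exact ⟨x, x.2, fun h => hx0 (Subtype.ext h), hx⟩

/-- Take u² = ab/|ab|. Then 4 Re(ū a) Re(ū b) = 2 Re(ū² ab) + 2 Re(a b̄) is the ellipse expression,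
so both real parts have the same sign; replacing u by -u makes them negative. -/
theorem exists_unit_re_neg {a b : ℂ} {c : ℝ} (hc : 0 ≤ c)
    (h : c < 2 * (‖a‖ * ‖b‖ + (a * star b).re)) :
    ∃ u : ℂ, ‖u‖ = 1 ∧ (star u * a).re < 0 ∧ (star u * b).re < 0 ∧
      c < 4 * ((star u * a).re * (star u * b).re) := by
  have hab : a * b ≠ 0 := by
    intro h0
    rcases mul_eq_zero.mp h0 with h0 | h0 <;> simp [h0] at h <;> linarith
  have hn : ‖a * b‖ ≠ 0 := norm_ne_zero_iff.mpr hab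
  obtain ⟨u, hu⟩ := IsAlgClosed.exists_pow_nat_eq (a * b / ‖a * b‖) two_pos
  have hu1 : ‖u‖ = 1 := by
    have h1 := congrArg norm hu
    rw [norm_pow, norm_div, Complex.norm_real, norm_norm, div_self hn] at h1
    exact (pow_eq_one_iff_of_nonneg (norm_nonneg u) two_ne_zero).mp h1
  have huu := mul_star_eq_one_of_norm_eq_one hu1
  have h2 : star u ^ 2 * (a * b) = ‖a * b‖ := by
    have : a * b = u ^ 2 * ‖a * b‖ := by
      rw [hu, div_mul_cancel₀]; exact_mod_cast hn
    calc star u ^ 2 * (a * b) = (u * star u) ^ 2 * ‖a * b‖ := by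
          linear_combination star u ^ 2 * this
      _ = _ := by rw [huu]; simp
  have key : 4 * ((star u * a).re * (star u * b).re) =
      2 * (‖a‖ * ‖b‖ + (a * star b).re) := by
    have e1 : (star u * a).re * (star u * b).re * 2 =
        (star u * a * (star u * b)).re + (star u * a * star (star u * b)).re := by
      simp only [Complex.mul_re, Complex.star_def, Complex.conj_re, Complex.conj_im]
      ring
    have e2 : star u * a * (star u * b) = ‖a * b‖ := by rw [← h2]; ring
    have e3 : star u * a * star (star u * b) = a * star b := by
      rw [star_mul', star_star]
      linear_combination a * star b * huu
    rw [e2, e3, Complex.ofReal_re, norm_mul] at e1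
    linarith
  have hpos : 0 < (star u * a).re * (star u * b).re := by linarith
  rcases pos_and_pos_or_neg_and_neg_of_mul_pos hpos with hp | hp
  · refine ⟨-u, by rwa [norm_neg], ?_, ?_, ?_⟩
    · rw [star_neg, neg_mul, Complex.neg_re]; linarith
    · rw [star_neg, neg_mul, Complex.neg_re]; linarith
    · rw [star_neg, neg_mul, neg_mul, Complex.neg_re, Complex.neg_re, neg_mul_neg, key]
      exact h
  · exact ⟨u, hu1, hp.1, hp.2, by rw [key]; exact h⟩

theorem ConstantSpectrum.le_of_mem_rankNumRange (h : ConstantSpectrum C D μ q) {c : ℝ}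
    (hc : 0 ≤ c) {k : ℕ} (hk : (Finset.univ.filter fun j => c < μ j).card < k) {α β z : ℂ}
    (hz : z ∈ rankNumRange k (scalarDiagBlocks α β C D)) :
    2 * (‖α - z‖ * ‖β - z‖ + ((α - z) * star (β - z)).re) ≤ c := by
  by_contra! hlt
  obtain ⟨u, hu, ha, hb, hab⟩ := exists_unit_re_neg hc hlt
  obtain ⟨S, hS, hiso⟩ := exists_subspace_isotropic_of_mem_rankNumRange hz
  set a := α - z
  set b := β - z
  have hw : ‖u ^ 2‖ = 1 := by rw [norm_pow, hu, one_pow]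
  have huu := mul_star_eq_one_of_norm_eq_one hu
  -- With w = u² the two off-diagonal terms of Re(ū x*Bx) combine into Re(ū x₁*N x₂).
  set N := C + u ^ 2 • Dᴴ with hN
  obtain ⟨L, hL⟩ := (Matrix.isHermitian_conjTranspose_mul_self N).exists_linearMap_form_le c
  obtain ⟨x, hxS, hx0, hLx⟩ := exists_mem_ne_zero_of_lt_finrank S
    (L ∘ₗ LinearMap.funLeft ℂ ℂ Sum.inr) (by
      rw [Module.finrank_fintype_fun_eq_card, hS,
        h.card_eigenvalues hw (fun x => c < x) (not_lt.mpr hc)]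
      exact hk)
  have hform := hiso x hxS x hxS
  rw [scalarDiagBlocks_form] at hform
  have hNx := hL (x ∘ Sum.inr) hLx
  rw [star_dotProduct_conjTranspose_mul_self_mulVec, star_dotProduct_self_eq_ofReal,
    Complex.ofReal_re] at hNx
  have hcs := norm_star_dotProduct_sq_le (x ∘ Sum.inl) (N *ᵥ (x ∘ Sum.inr))
  rw [star_dotProduct_self_eq_ofReal, star_dotProduct_self_eq_ofReal] at hform
  set P := ∑ i, ‖(x ∘ Sum.inl) i‖ ^ 2 with hP
  set Q := ∑ i, ‖(x ∘ Sum.inr) i‖ ^ 2 with hQ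
  have hP0 : 0 ≤ P := Finset.sum_nonneg fun _ _ => sq_nonneg _
  have hQ0 : 0 ≤ Q := Finset.sum_nonneg fun _ _ => sq_nonneg _
  set t := star (x ∘ Sum.inl) ⬝ᵥ (N *ᵥ (x ∘ Sum.inr)) with ht
  have hre : (star u * a).re * P + (star u * t).re + (star u * b).re * Q = 0 := by
    have e1 : t = star (x ∘ Sum.inl) ⬝ᵥ (C *ᵥ (x ∘ Sum.inr)) +
        u ^ 2 * star (star (x ∘ Sum.inr) ⬝ᵥ (D *ᵥ (x ∘ Sum.inl))) := by
      rw [ht, hN, Matrix.add_mulVec, Matrix.smul_mulVec, dotProduct_add, dotProduct_smul,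
        star_dotProduct_mulVec_conj, smul_eq_mul]
    have e2 := congrArg (fun y => (star u * y).re) hform
    simp only [mul_zero, Complex.zero_re] at e2
    have e3 : ∀ y : ℂ, (star u * (u ^ 2 * star y)).re = (star u * y).re := by
      intro y
      have : star u * (u ^ 2 * star y) = star (star u * y) := by
        rw [star_mul', star_star]
        linear_combination u * star y * huu
      rw [this, Complex.star_def, Complex.conj_re]
    rw [e1, mul_add, Complex.add_re, e3]
    simp only [mul_add, Complex.add_re, ← mul_assoc, Complex.re_mul_ofReal] at e2
    linarith
  have htn : |(star u * t).re| ^ 2 ≤ P * (c * Q) := by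
    have h1 := Complex.abs_re_le_norm (star u * t)
    rw [norm_mul, norm_star, hu, one_mul] at h1
    calc |(star u * t).re| ^ 2 ≤ ‖t‖ ^ 2 := pow_le_pow_left₀ (abs_nonneg _) h1 2
      _ ≤ _ := hcs.trans (mul_le_mul_of_nonneg_left hNx hP0)
  rw [sq_abs] at htn
  set A := (star u * a).re
  set B := (star u * b).re
  have h4 : (A * P + B * Q) ^ 2 ≤ P * (c * Q) := by
    have : (A * P + B * Q) ^ 2 = (star u * t).re ^ 2 := by
      have : A * P + B * Q = -(star u * t).re := by linarith
      rw [this]; ring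
    rw [this]; exact htn
  -- By AM-GM, 4AB·PQ ≤ (AP + BQ)² ≤ c·PQ. As 4AB > c, this forces PQ = 0, and then AP + BQ = 0 with
  -- A, B < 0 forces x = 0.
  have h5 : (4 * (A * B) - c) * (P * Q) ≤ 0 := by nlinarith [sq_nonneg (A * P - B * Q)]
  have hPQ : P * Q = 0 := by
    by_contra hne
    have : 0 < P * Q := lt_of_le_of_ne (mul_nonneg hP0 hQ0) (Ne.symm hne)
    nlinarith
  have h6 : A * P + B * Q = 0 := by
    have : P * (c * Q) = 0 := by linear_combination c * hPQ
    rw [this] at h4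
    exact pow_eq_zero_iff two_ne_zero |>.mp (le_antisymm h4 (sq_nonneg _))
  have h7 := mul_nonpos_of_nonpos_of_nonneg ha.le hP0
  have h8 := mul_nonpos_of_nonpos_of_nonneg hb.le hQ0
  have hPz : P = 0 := (mul_eq_zero.mp (by linarith : A * P = 0)).resolve_left ha.ne
  have hQz : Q = 0 := (mul_eq_zero.mp (by linarith : B * Q = 0)).resolve_left hb.ne
  refine hx0 (funext ?_)
  rintro (i | i)
  · exact congrFun (sum_norm_sq_eq_zero hPz) i
  · exact congrFun (sum_norm_sq_eq_zero hQz) i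

/-- An isotropic subspace of dimension above s contains a nonzero vector supported on the first
block, where the form is (α - z)|x|². -/
theorem eq_left_of_mem_rankNumRange {k : ℕ} (hk : s < k) {α β z : ℂ}
    (hz : z ∈ rankNumRange k (scalarDiagBlocks α β C D)) : z = α := by
  obtain ⟨S, hS, hiso⟩ := exists_subspace_isotropic_of_mem_rankNumRange hz
  obtain ⟨x, hxS, hx0, hx⟩ := exists_mem_ne_zero_of_lt_finrank S
    (LinearMap.funLeft ℂ ℂ (Sum.inr : Fin s → Fin r ⊕ Fin s)) (by
      rw [Module.finrank_fintype_fun_eq_card, hS, Fintype.card_fin]; exact hk)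
  have hx : x ∘ Sum.inr = 0 := hx
  have hform := hiso x hxS x hxS
  rw [scalarDiagBlocks_form, hx] at hform
  simp only [Matrix.mulVec_zero, dotProduct_zero, add_zero, star_zero, zero_dotProduct,
    mul_zero] at hform
  rcases mul_eq_zero.mp hform with h | h
  · exact (sub_eq_zero.mp h).symm
  · refine absurd (funext ?_) hx0
    rw [star_dotProduct_self_eq_ofReal, Complex.ofReal_eq_zero] at h
    rintro (i | i)
    · exact congrFun (sum_norm_sq_eq_zero h) i
    · exact congrFun hx i

theorem scalarDiagBlocks_submatrix_sumComm (α β : ℂ) (C : Matrix (Fin r) (Fin s) ℂ)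
    (D : Matrix (Fin s) (Fin r) ℂ) :
    (scalarDiagBlocks α β C D).submatrix (Equiv.sumComm (Fin s) (Fin r))
      (Equiv.sumComm (Fin s) (Fin r)) = scalarDiagBlocks β α D C := by
  ext (i | i) (j | j) <;> simp [scalarDiagBlocks]

theorem rankNumRange_scalarDiagBlocks_swap (k : ℕ) (α β : ℂ) (C : Matrix (Fin r) (Fin s) ℂ)
    (D : Matrix (Fin s) (Fin r) ℂ) :
    rankNumRange k (scalarDiagBlocks β α D C) = rankNumRange k (scalarDiagBlocks α β C D) := by
  rw [← scalarDiagBlocks_submatrix_sumComm, rankNumRange_submatrix]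

theorem eq_right_of_mem_rankNumRange {k : ℕ} (hk : r < k) {α β z : ℂ}
    (hz : z ∈ rankNumRange k (scalarDiagBlocks α β C D)) : z = β := by
  rw [← rankNumRange_scalarDiagBlocks_swap] at hz
  exact eq_left_of_mem_rankNumRange hk hz

theorem left_mem_rankNumRange {k : ℕ} (hk : k ≤ r) (α β : ℂ) (C : Matrix (Fin r) (Fin s) ℂ)
    (D : Matrix (Fin s) (Fin r) ℂ) : α ∈ rankNumRange k (scalarDiagBlocks α β C D) := by
  let L : Matrix (Fin r ⊕ Fin s) (Fin r) ℂ := Matrix.fromRows 1 0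
  have hL : Lᴴ * L = 1 := by
    rw [Matrix.conjTranspose_fromRows_eq_fromCols_conjTranspose, Matrix.fromCols_mul_fromRows]
    simp
  have hA : Lᴴ * scalarDiagBlocks α β C D * L = α • (1 : Matrix (Fin r) (Fin r) ℂ) := by
    rw [Matrix.conjTranspose_fromRows_eq_fromCols_conjTranspose, scalarDiagBlocks,
      Matrix.mul_assoc, Matrix.fromBlocks_mul_fromRows, Matrix.fromCols_mul_fromRows]
    simp
  refine rankNumRange_compression_subset _ L hL ?_
  refine mem_rankNumRange_of_subspace ⊤ (by simpa using hk) fun x _ y _ => ?_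
  rw [hA, Matrix.smul_mulVec, Matrix.one_mulVec, dotProduct_smul, smul_eq_mul]

end Bounds

/-! ### The segment between the foci, for arbitrary C and D. -/

section Segment

open scoped ComplexOrder

variable {r s : ℕ}

/-- On the segment the real quadratic d is nonnegative on the whole circle, and B - lB* has
determinant l^s det(N*N + d). Invertibility of N makes N*N + d positive definite even where d = 0.
-/
theorem mem_rankNumRange_of_det_pencil_ne_zero {C D : Matrix (Fin s) (Fin s) ℂ}
    (h : ∀ w : ℂ, ‖w‖ = 1 → (C + w • Dᴴ).det ≠ 0) {α β z : ℂ}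
    (hz : 2 * (‖α - z‖ * ‖β - z‖ + ((α - z) * star (β - z)).re) ≤ 0) :
    z ∈ rankNumRange s (scalarDiagBlocks α β C D) := by
  refine mem_rankNumRange_of_isotropic ?_
  rw [scalarDiagBlocks_sub_smul_one]
  refine exists_isotropic_of_det_ne_zero (by simp [two_mul]) fun l hl => ?_
  have hl' : ‖-l‖ = 1 := by rwa [norm_neg]
  have hl0 : l ≠ 0 := by rintro rfl; simp at hl
  set a := α - z
  set b := β - z
  rw [scalarDiagBlocks_sub_smul_conjTranspose, det_fromBlocks_smul_one le_rfl, Nat.sub_self,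
    pow_zero, one_mul, quadratic_eq_of_norm_eq_one a b hl, ← smul_conjTranspose_add_smul C D hl']
  set d : ℝ := 2 * (star l * (a * b)).re - 2 * (a * star b).re with hd
  have hd0 : 0 ≤ d := by
    have := neg_mul_norm_le_re hl a b
    linarith
  set N := C + (-l) • Dᴴ with hN
  have hpos : (Nᴴ * N + (d : ℂ) • (1 : Matrix (Fin s) (Fin s) ℂ)).PosDef := by
    refine Matrix.PosDef.add_posSemidef (Matrix.PosDef.conjTranspose_mul_self N ?_) ?_
    · exact Matrix.mulVec_injective_iff_isUnit.mpr
        ((Matrix.isUnit_iff_isUnit_det _).mpr (isUnit_iff_ne_zero.mpr (h _ hl')))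
    · exact Matrix.PosSemidef.one.smul (by exact_mod_cast hd0)
  have heq : (l * (d : ℂ)) • (1 : Matrix (Fin s) (Fin s) ℂ) - ((-l) • Nᴴ) * N =
      l • (Nᴴ * N + (d : ℂ) • (1 : Matrix (Fin s) (Fin s) ℂ)) := by
    rw [Matrix.smul_mul, neg_smul, sub_neg_eq_add, smul_add, smul_smul, add_comm]
  rw [heq, Matrix.det_smul]
  exact mul_ne_zero (pow_ne_zero _ hl0) hpos.det_pos.ne'

theorem eq_univ_of_isClosed_of_finite_compl {X : Type*} [TopologicalSpace X] [T1Space X]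
    [∀ x : X, (nhdsWithin x {x}ᶜ).NeBot] {F t : Set X} (hF : IsClosed F) (ht : t.Finite)
    (h : tᶜ ⊆ F) : F = Set.univ := by
  have hd : Dense (tᶜ : Set X) := by
    have := dense_univ.sdiff_finite ht
    rwa [← Set.compl_eq_univ_sdiff] at this
  exact Set.eq_univ_of_univ_subset (hd.closure_eq.symm.subset.trans (closure_minimal h hF))

theorem exists_polynomial_det_pencil (C D : Matrix (Fin s) (Fin s) ℂ) :
    ∃ P : Polynomial ℂ, ∀ w, P.eval w = (C + w • D).det := by
  refine ⟨(C.map Polynomial.C + (Polynomial.X : Polynomial ℂ) • D.map Polynomial.C).det,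
    fun w => ?_⟩
  rw [← Polynomial.coe_evalRingHom, RingHom.map_det]
  congr 1
  ext i j
  simp [mul_comm w]

theorem isClosed_setOf_mem_rankNumRange {X : Type*} [TopologicalSpace X] (k : ℕ) (α β z : ℂ)
    {C : X → Matrix (Fin r) (Fin s) ℂ} {D : X → Matrix (Fin s) (Fin r) ℂ} (hC : Continuous C)
    (hD : Continuous D) : IsClosed {t | z ∈ rankNumRange k (scalarDiagBlocks α β (C t) (D t))} := by
  have hc : Continuous fun t => scalarDiagBlocks α β (C t) (D t) :=
    continuous_const.matrix_fromBlocks hC hD continuous_const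
  exact (isClosed_rankNumRange_graph k).preimage (hc.prodMk (continuous_const (y := z)))

theorem mem_rankNumRange_of_det_ne_zero {C : Matrix (Fin s) (Fin s) ℂ} (hC : C.det ≠ 0)
    (D : Matrix (Fin s) (Fin s) ℂ) {α β z : ℂ}
    (hz : 2 * (‖α - z‖ * ‖β - z‖ + ((α - z) * star (β - z)).re) ≤ 0) :
    z ∈ rankNumRange s (scalarDiagBlocks α β C D) := by
  obtain ⟨P, hP⟩ := exists_polynomial_det_pencil C Dᴴ
  have hP0 : P ≠ 0 := by
    rintro rfl
    have := hP 0
    simp only [Polynomial.eval_zero, zero_smul, add_zero] at this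
    exact hC this.symm
  have hF := isClosed_setOf_mem_rankNumRange s α β z (C := fun _ : ℝ => C)
    (D := fun t : ℝ => (t : ℂ) • D) continuous_const (by fun_prop)
  -- Replacing D by tD, the pencil degenerates on the unit circle only if |t| is the modulus of a
  -- root of det(C + wD*). Closedness fills in the finitely many excluded t, so t = 1 is allowed.
  let bad : Set ℝ := (fun w : ℂ => ‖w‖) '' P.rootSet ℂ ∪ (fun w : ℂ => -‖w‖) '' P.rootSet ℂ
  have hbad : bad.Finite :=
    ((P.rootSet_finite ℂ).image _).union ((P.rootSet_finite ℂ).image _)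
  have huniv := eq_univ_of_isClosed_of_finite_compl hF hbad (by
    intro t ht
    refine mem_rankNumRange_of_det_pencil_ne_zero (fun w hw h0 => ht ?_) hz
    have hroot : w * t ∈ P.rootSet ℂ := by
      rw [Polynomial.mem_rootSet]
      refine ⟨hP0, ?_⟩
      rw [Polynomial.coe_aeval_eq_eval, hP, ← h0, Matrix.conjTranspose_smul, smul_smul,
        Complex.star_def, Complex.conj_ofReal]
    have hn : ‖w * (t : ℂ)‖ = |t| := by
      rw [norm_mul, hw, one_mul, Complex.norm_real, Real.norm_eq_abs]
    rcases le_total 0 t with h | h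
    · exact Or.inl ⟨_, hroot, by simp only [hn, abs_of_nonneg h]⟩
    · exact Or.inr ⟨_, hroot, by simp only [hn, abs_of_nonpos h, neg_neg]⟩)
  have h1 : z ∈ rankNumRange s (scalarDiagBlocks α β C (((1 : ℝ) : ℂ) • D)) :=
    Set.eq_univ_iff_forall.mp huniv 1
  rwa [Complex.ofReal_one, one_smul] at h1

theorem mem_rankNumRange_square (C D : Matrix (Fin s) (Fin s) ℂ) {α β z : ℂ}
    (hz : 2 * (‖α - z‖ * ‖β - z‖ + ((α - z) * star (β - z)).re) ≤ 0) :
    z ∈ rankNumRange s (scalarDiagBlocks α β C D) := by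
  have hF : IsClosed {e : ℂ | z ∈ rankNumRange s
      (scalarDiagBlocks α β (C + e • (1 : Matrix (Fin s) (Fin s) ℂ)) D)} :=
    isClosed_setOf_mem_rankNumRange s α β z
      (C := fun e : ℂ => C + e • (1 : Matrix (Fin s) (Fin s) ℂ)) (D := fun _ => D)
      (by fun_prop) continuous_const
  have hfin : {e : ℂ | (-C).charpoly.IsRoot e}.Finite :=
    Polynomial.finite_setOfPred_isRoot (-C).charpoly_monic.ne_zero
  have huniv := eq_univ_of_isClosed_of_finite_compl hF hfin (by
    intro e he
    rw [Set.mem_compl_iff, Set.mem_ofPred_eq, Polynomial.IsRoot, Matrix.eval_charpoly,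
      Matrix.scalar_apply, ← Matrix.smul_one_eq_diagonal, sub_neg_eq_add, add_comm] at he
    rw [Set.mem_ofPred_eq]
    exact mem_rankNumRange_of_det_ne_zero he D hz)
  have h1 := Set.eq_univ_iff_forall.mp huniv 0
  rwa [Set.mem_ofPred_eq, zero_smul, add_zero] at h1

theorem segment_subset_rankNumRange (hsr : s ≤ r) {k : ℕ} (hk : k ≤ s) (α β : ℂ)
    (C : Matrix (Fin r) (Fin s) ℂ) (D : Matrix (Fin s) (Fin r) ℂ) :
    segment ℝ α β ⊆ rankNumRange k (scalarDiagBlocks α β C D) := by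
  intro z hz
  rw [← ellipticalDisc_zero, mem_ellipticalDisc_iff, zero_pow two_ne_zero] at hz
  refine rankNumRange_anti hk _ ?_
  -- Compressing the first block to s of its coordinates keeps both diagonal blocks scalar and
  -- reduces to square C and D.
  let J : Matrix (Fin r) (Fin s) ℂ :=
    (1 : Matrix (Fin r) (Fin r) ℂ).submatrix id (Fin.castLE hsr)
  have hJ : Jᴴ * J = 1 := by
    rw [Matrix.conjTranspose_submatrix, Matrix.conjTranspose_one,
      ← Matrix.submatrix_mul _ _ _ _ _ Function.bijective_id, Matrix.one_mul,
      Matrix.submatrix_one _ (Fin.castLE_injective hsr)]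
  let L : Matrix (Fin r ⊕ Fin s) (Fin s ⊕ Fin s) ℂ := Matrix.fromBlocks J 0 0 1
  have hL : Lᴴ * L = 1 := by
    simp only [L, Matrix.fromBlocks_conjTranspose, Matrix.fromBlocks_multiply, hJ,
      Matrix.conjTranspose_zero, Matrix.conjTranspose_one, Matrix.mul_zero, Matrix.zero_mul,
      Matrix.mul_one, add_zero, zero_add, Matrix.fromBlocks_one]
  have hA : Lᴴ * scalarDiagBlocks α β C D * L = scalarDiagBlocks α β (Jᴴ * C) (D * J) := by
    simp only [L, scalarDiagBlocks, Matrix.fromBlocks_conjTranspose, Matrix.fromBlocks_multiply,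
      Matrix.conjTranspose_zero, Matrix.conjTranspose_one, Matrix.mul_zero, Matrix.zero_mul,
      Matrix.mul_one, Matrix.one_mul, add_zero, zero_add, Matrix.mul_smul, Matrix.smul_mul, hJ,
      smul_zero]
  refine rankNumRange_compression_subset _ L hL ?_
  rw [hA]
  exact mem_rankNumRange_square _ _ hz

end Segment

/-! ### The largest eigenvalue as a spectral norm. -/

section Norm

open scoped ComplexOrder

variable {r s : ℕ} {C : Matrix (Fin r) (Fin s) ℂ} {D : Matrix (Fin s) (Fin r) ℂ} {p q : ℕ}
  {μ : Fin p → ℝ}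

theorem Matrix.IsHermitian.l2_opNorm_eq {m : Type*} [Fintype m] [DecidableEq m]
    {A : Matrix m m ℂ} (hA : A.IsHermitian) : ‖A‖ = ‖hA.eigenvalues‖ := by
  have h1 : ‖A‖ = ‖Matrix.diagonal (RCLike.ofReal ∘ hA.eigenvalues : m → ℂ)‖ := by
    conv_lhs => rw [hA.spectral_theorem]
    exact StarAlgEquiv.norm_map _ _
  rw [h1, Matrix.l2_opNorm_diagonal]
  simp only [Pi.norm_def, Function.comp_apply]
  congr 2
  funext i
  ext
  simp

theorem ConstantSpectrum.l2_opNorm_sq (h : ConstantSpectrum C D μ q) (hp : 0 < p) :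
    ‖C + Dᴴ‖ ^ 2 = μ ⟨0, hp⟩ := by
  have hmap := h.map_eigenvalues (w := 1) (by simp)
  rw [← one_smul ℂ Dᴴ, sq, ← Matrix.l2_opNorm_conjTranspose_mul_self,
    (Matrix.isHermitian_conjTranspose_mul_self _).l2_opNorm_eq]
  refine le_antisymm ((pi_norm_le_iff_of_nonneg (h.pos _).le).mpr fun i => ?_) ?_
  · have hi := Multiset.mem_map_of_mem
      (Matrix.isHermitian_conjTranspose_mul_self (C + (1 : ℂ) • Dᴴ)).eigenvalues
      (Finset.mem_univ_val i)
    rw [hmap, Multiset.mem_add, Multiset.mem_map] at hi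
    rcases hi with ⟨j, -, hj⟩ | hi
    · rw [← hj, Real.norm_eq_abs, abs_of_pos (h.pos j)]
      exact h.anti (Fin.mk_le_of_le_val (Nat.zero_le _))
    · rw [Multiset.eq_of_mem_replicate hi, norm_zero]
      exact (h.pos _).le
  · have h2 : μ ⟨0, hp⟩ ∈ Multiset.map μ Finset.univ.val + Multiset.replicate q 0 :=
      Multiset.mem_add.mpr (Or.inl (Multiset.mem_map_of_mem _ (Finset.mem_univ_val _)))
    rw [← hmap, Multiset.mem_map] at h2
    obtain ⟨i, -, hi⟩ := h2
    rw [← hi]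
    exact (Real.le_norm_self _).trans (norm_le_pi_norm _ i)

theorem ConstantSpectrum.add_conjTranspose_eq_zero (h : ConstantSpectrum C D μ q) (hp : p = 0) :
    C + Dᴴ = 0 := by
  have := h.rank (w := 1) (by simp)
  rw [one_smul, hp] at this
  have h1 := LinearMap.range_eq_bot.mp (Submodule.finrank_eq_zero.mp this)
  rw [← Matrix.toLin'_apply'] at h1
  exact (LinearEquiv.map_eq_zero_iff _).mp h1

end Norm

/-! ### Equal foci: the range of `k` up to n - p. -/

section EqualFoci

open scoped ComplexOrder

variable {r s : ℕ} {C : Matrix (Fin r) (Fin s) ℂ} {D : Matrix (Fin s) (Fin r) ℂ} {p q : ℕ}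
  {μ : Fin p → ℝ}

theorem star_dotProduct_self_eq_zero {m : Type*} [Fintype m] {x : m → ℂ}
    (h : star x ⬝ᵥ x = 0) : x = 0 := by
  rw [star_dotProduct_self_eq_ofReal, Complex.ofReal_eq_zero] at h
  exact sum_norm_sq_eq_zero h

/-- The vectors (Nv, v) with v in the range of N* form a p-dimensional space on which the real part
of the form of A - α is |Nv|², positive unless v = 0. An isotropic subspace meets it trivially. -/
theorem ConstantSpectrum.le_sub_of_mem_rankNumRange (h : ConstantSpectrum C D μ q) {α : ℂ} {k : ℕ}
    (hα : α ∈ rankNumRange k (scalarDiagBlocks α α C D)) : k ≤ r + s - p := by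
  obtain ⟨S, hS, hiso⟩ := exists_subspace_isotropic_of_mem_rankNumRange hα
  rw [sub_self] at hiso
  set N := C + Dᴴ with hN
  have hrank : Nᴴ.rank = p := by
    have := h.rank (w := 1) (by simp)
    rwa [one_smul, ← Matrix.rank_conjTranspose] at this
  have hH : ∀ x ∈ S, star (x ∘ Sum.inl) ⬝ᵥ (N *ᵥ (x ∘ Sum.inr)) +
      star (star (x ∘ Sum.inl) ⬝ᵥ (N *ᵥ (x ∘ Sum.inr))) = 0 := by
    intro x hx
    have h1 := hiso x hx x hx
    rw [scalarDiagBlocks_form] at h1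
    have h2 := congrArg star h1
    simp only [zero_mul, zero_add, add_zero, star_add, star_zero] at h1 h2
    rw [star_dotProduct_mulVec_conj D] at h2
    rw [hN, Matrix.add_mulVec, dotProduct_add, star_add,
      star_dotProduct_mulVec_conj Dᴴ, Matrix.conjTranspose_conjTranspose]
    linear_combination h1 + h2
  let E : (Fin s → ℂ) →ₗ[ℂ] (Fin r ⊕ Fin s → ℂ) :=
    (LinearEquiv.sumArrowLequivProdArrow (Fin r) (Fin s) ℂ ℂ).symm.toLinearMap ∘ₗ
      N.mulVecLin.prod LinearMap.id
  have hEl : ∀ v, E v ∘ Sum.inl = N *ᵥ v := fun v => by ext; simp [E]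
  have hEr : ∀ v, E v ∘ Sum.inr = v := fun v => by ext; simp [E]
  have hEinj : Function.Injective E := fun v w hvw => by rw [← hEr v, hvw, hEr]
  let P := (LinearMap.range Nᴴ.mulVecLin).map E
  have hP : Module.finrank ℂ P = p := by
    rw [← hrank]
    exact (Submodule.equivMapOfInjective E hEinj _).finrank_eq.symm
  have hdisj : Disjoint S P := by
    rw [Submodule.disjoint_def]
    rintro _ hxS ⟨_, ⟨y, rfl⟩, rfl⟩
    have h1 := hH _ hxS
    rw [Matrix.mulVecLin_apply, hEl, hEr, star_dotProduct_self_eq_ofReal, Complex.star_def, Complex.conj_ofReal,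
      ← two_mul] at h1
    have h2 : N *ᵥ (Nᴴ *ᵥ y) = 0 :=
      sum_norm_sq_eq_zero (by simpa only [mul_eq_zero, OfNat.ofNat_ne_zero, false_or,
        Complex.ofReal_eq_zero] using h1)
    have h3 : Nᴴ *ᵥ y = 0 := by
      apply star_dotProduct_self_eq_zero
      rw [Matrix.star_mulVec, Matrix.conjTranspose_conjTranspose, ← Matrix.dotProduct_mulVec, h2,
        dotProduct_zero]
    rw [Matrix.mulVecLin_apply, h3, map_zero]
  have := Submodule.finrank_add_finrank_le_of_disjoint hdisj
  rw [hS, hP, Module.finrank_fintype_fun_eq_card, Fintype.card_sum, Fintype.card_fin,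
    Fintype.card_fin] at this
  omega

theorem finrank_submodule_prod {V W : Type*} [AddCommGroup V] [Module ℂ V] [AddCommGroup W]
    [Module ℂ W] [FiniteDimensional ℂ V] [FiniteDimensional ℂ W] (S : Submodule ℂ V)
    (T : Submodule ℂ W) :
    Module.finrank ℂ (S.prod T) = Module.finrank ℂ S + Module.finrank ℂ T := by
  have h : S.prod T = LinearMap.range (S.subtype.prodMap T.subtype) := by
    rw [LinearMap.range_prodMap, Submodule.range_subtype, Submodule.range_subtype]
  rw [h, LinearMap.finrank_range_of_inj, Module.finrank_prod]
  exact Function.Injective.prodMap S.injective_subtype T.injective_subtype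

theorem exists_orthogonal {m : Type*} [Fintype m] (W : Submodule ℂ (m → ℂ)) :
    ∃ U : Submodule ℂ (m → ℂ), Module.finrank ℂ W + Module.finrank ℂ U = Fintype.card m ∧
      ∀ u ∈ U, ∀ y ∈ W, star u ⬝ᵥ y = 0 := by
  let e : EuclideanSpace ℂ m ≃ₗ[ℂ] (m → ℂ) := WithLp.linearEquiv 2 ℂ (m → ℂ)
  refine ⟨((W.map e.symm.toLinearMap)ᗮ).map e.toLinearMap, ?_, ?_⟩
  · rw [LinearEquiv.finrank_map_eq, ← LinearEquiv.finrank_map_eq e.symm W,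
      Submodule.finrank_add_finrank_orthogonal, finrank_euclideanSpace]
  · rintro _ ⟨u, hu, rfl⟩ y hy
    have := (Submodule.mem_orthogonal' _ u).mp hu _ ⟨y, hy, rfl⟩
    rw [EuclideanSpace.inner_eq_star_dotProduct, dotProduct_comm] at this
    exact this

-- Cayley-Hamilton gives (N*N)^q g(N*N) = 0 for g = ∏(X - μ_j). Since N*N is Hermitian, the power
-- can be lowered to one, and then N* cancels.
open Polynomial in
theorem ConstantSpectrum.mul_aeval_eq_zero (h : ConstantSpectrum C D μ q) {w : ℂ} (hw : ‖w‖ = 1) :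
    (C + w • Dᴴ) * aeval ((C + w • Dᴴ)ᴴ * (C + w • Dᴴ))
      (∏ j, (X - Polynomial.C (μ j : ℂ))) = 0 := by
  set N := C + w • Dᴴ
  set Y := aeval (Nᴴ * N) (∏ j, (X - Polynomial.C (μ j : ℂ)))
  have hCH := Matrix.aeval_self_charpoly (Nᴴ * N)
  rw [h.charpoly_eq w hw, mul_comm, map_mul, map_pow, aeval_X] at hCH
  have key : ∀ n : ℕ, (Nᴴ * N) ^ n * Y = 0 → Nᴴ * N * Y = 0 := by
    intro n
    induction n with
    | zero =>
      intro h0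
      rw [pow_zero, one_mul] at h0
      rw [h0, mul_zero]
    | succ n ih =>
      rcases n with _ | n
      · intro h1
        simpa using h1
      · intro h2
        apply ih
        have hM : (Nᴴ * N)ᴴ = Nᴴ * N := Matrix.isHermitian_conjTranspose_mul_self N
        rw [pow_succ', mul_assoc] at h2 ⊢
        rw [pow_succ', mul_assoc, ← mul_assoc] at h2
        nth_rw 1 [← hM] at h2
        exact (Matrix.conjTranspose_mul_self_mul_eq_zero _ _).mp h2
  exact (Matrix.conjTranspose_mul_self_mul_eq_zero _ _).mp (key q hCH)

theorem Polynomial.aeval_mulVec_of_mulVec_eq_zero {m : Type*} [Fintype m] [DecidableEq m]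
    {M : Matrix m m ℂ} {v : m → ℂ} (hv : M *ᵥ v = 0) (g : Polynomial ℂ) :
    Polynomial.aeval M g *ᵥ v = g.coeff 0 • v := by
  conv_lhs => rw [← Polynomial.divX_mul_X_add g]
  rw [map_add, map_mul, Polynomial.aeval_X, Polynomial.aeval_C, Matrix.add_mulVec,
    ← Matrix.mulVec_mulVec, hv, Matrix.mulVec_zero, zero_add, Algebra.algebraMap_eq_smul_one,
    Matrix.smul_mulVec, Matrix.one_mulVec]

/-- The sum of the kernels of `C + w D*` over the unimodular `w`. -/
noncomputable def pencilKernelSum (C : Matrix (Fin r) (Fin s) ℂ) (D : Matrix (Fin s) (Fin r) ℂ) :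
    Submodule ℂ (Fin s → ℂ) :=
  ⨆ w : {w : ℂ // ‖w‖ = 1}, LinearMap.ker (C + (w : ℂ) • Dᴴ).mulVecLin

theorem mem_pencilKernelSum {w : ℂ} (hw : ‖w‖ = 1) {v : Fin s → ℂ}
    (hv : (C + w • Dᴴ) *ᵥ v = 0) : v ∈ pencilKernelSum C D :=
  Submodule.mem_iSup_of_mem (p := fun w : {w : ℂ // ‖w‖ = 1} =>
    LinearMap.ker (C + (w : ℂ) • Dᴴ).mulVecLin) ⟨w, hw⟩ hv

theorem mulVec_mem_map_of_ne_one {w : ℂ} (hw : ‖w‖ = 1) (hw1 : w ≠ 1) {v : Fin s → ℂ}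
    (hv : (C + w • Dᴴ) *ᵥ v = 0) :
    Dᴴ *ᵥ v ∈ (pencilKernelSum C D).map (C + Dᴴ).mulVecLin := by
  refine ⟨(1 - w)⁻¹ • v, Submodule.smul_mem _ _ (mem_pencilKernelSum hw hv), ?_⟩
  have h1 : (C + Dᴴ) *ᵥ v = (1 - w) • (Dᴴ *ᵥ v) := by
    rw [Matrix.add_mulVec, Matrix.smul_mulVec] at hv
    rw [Matrix.add_mulVec, eq_neg_of_add_eq_zero_left hv]
    module
  rw [map_smul, Matrix.mulVecLin_apply, h1, smul_smul,
    inv_mul_cancel₀ (sub_ne_zero.mpr hw1.symm), one_smul]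

/-- For w ≠ 1 the kernel equation gives (C + D*)v = (1 - w)D*v. At w = 1 this is void, so v is
approached by g(N_w* N_w)v, which lies in ker N_w and tends to g(0)v with g(0) ≠ 0. One polynomial g
serves all w because the spectrum is constant. -/
theorem ConstantSpectrum.mulVec_mem_map (h : ConstantSpectrum C D μ q) {w : ℂ} (hw : ‖w‖ = 1)
    {v : Fin s → ℂ} (hv : (C + w • Dᴴ) *ᵥ v = 0) :
    Dᴴ *ᵥ v ∈ (pencilKernelSum C D).map (C + Dᴴ).mulVecLin := by
  by_cases hw1 : w = 1
  swap
  · exact mulVec_mem_map_of_ne_one hw hw1 hv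
  subst hw1
  set W := (pencilKernelSum C D).map (C + Dᴴ).mulVecLin
  let g : Polynomial ℂ := ∏ j, (Polynomial.X - Polynomial.C (μ j : ℂ))
  let M : ℝ → Matrix (Fin s) (Fin s) ℂ := fun θ =>
    (C + Complex.exp (θ * Complex.I) • Dᴴ)ᴴ * (C + Complex.exp (θ * Complex.I) • Dᴴ)
  let f : ℝ → Fin r → ℂ := fun θ => Dᴴ *ᵥ (Polynomial.aeval (M θ) g *ᵥ v)
  have hM : Continuous M := by fun_prop
  have hf : Continuous f := by
    have := (Polynomial.continuous_aeval g).comp hM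
    exact continuous_const.matrix_mulVec (this.matrix_mulVec continuous_const)
  have hg0 : g.coeff 0 ≠ 0 := by
    rw [Polynomial.coeff_zero_eq_eval_zero, Polynomial.eval_prod]
    exact Finset.prod_ne_zero_iff.mpr fun j _ => by simpa using h.ne_zero j
  have hf0 : f 0 = g.coeff 0 • (Dᴴ *ᵥ v) := by
    have h1 : M 0 *ᵥ v = 0 := by
      simp only [M, Complex.ofReal_zero, zero_mul, Complex.exp_zero]
      rw [← Matrix.mulVec_mulVec, hv, Matrix.mulVec_zero]
    simp only [f]
    rw [Polynomial.aeval_mulVec_of_mulVec_eq_zero h1, Matrix.mulVec_smul]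
  have hmem : f 0 ∈ W := by
    have hclosed : IsClosed (W : Set (Fin r → ℂ)) := Submodule.closed_of_finiteDimensional W
    have hlim : Filter.Tendsto f (nhdsWithin 0 (Set.Ioi 0)) (nhds (f 0)) :=
      (hf.tendsto 0).mono_left nhdsWithin_le_nhds
    refine hclosed.mem_of_tendsto hlim ?_
    have hev : ∀ᶠ θ : ℝ in nhdsWithin 0 (Set.Ioi 0), 0 < θ ∧ θ < 2 * Real.pi :=
      Filter.Eventually.and self_mem_nhdsWithin
        (nhdsWithin_le_nhds (Iio_mem_nhds Real.two_pi_pos))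
    filter_upwards [hev] with θ hθ
    have hnorm : ‖Complex.exp (θ * Complex.I)‖ = 1 := Complex.norm_exp_ofReal_mul_I θ
    refine mulVec_mem_map_of_ne_one hnorm ?_ ?_
    · intro h1
      obtain ⟨n, hn⟩ := Complex.exp_eq_one_iff.mp h1
      have h2 : θ = n * (2 * Real.pi) := by
        have h3 := congrArg Complex.im hn
        simpa using h3
      have hπ := Real.two_pi_pos
      have h3 : (0 : ℝ) < n := by
        by_contra! hle
        nlinarith [hθ.1]
      have h4 : (n : ℝ) < 1 := by
        by_contra! hle
        nlinarith [hθ.2]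
      have h5 : (0 : ℤ) < n := by exact_mod_cast h3
      have h6 : n < (1 : ℤ) := by exact_mod_cast h4
      omega
    · rw [Matrix.mulVec_mulVec]
      have := h.mul_aeval_eq_zero hnorm
      simp only [M, g]
      rw [this, Matrix.zero_mulVec]
  rw [hf0] at hmem
  exact (Submodule.smul_mem_iff _ hg0).mp hmem

/-- Let V be the sum of the kernels, W = (C + D*)V and U = W^⊥. Both C and D* map V into W, so U ⊕ V
is isotropic for A - α, whose diagonal blocks vanish. -/
theorem ConstantSpectrum.left_mem_rankNumRange (h : ConstantSpectrum C D μ q) {k : ℕ}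
    (hk : k ≤ r + s - p) (α : ℂ) : α ∈ rankNumRange k (scalarDiagBlocks α α C D) := by
  set V := pencilKernelSum C D with hV
  set N := C + Dᴴ with hN
  let f : (Fin s → ℂ) →ₗ[ℂ] (Fin r → ℂ) := N.mulVecLin
  obtain ⟨W, hW⟩ : ∃ W : Submodule ℂ (Fin r → ℂ), W = V.map f := ⟨_, rfl⟩
  have hD : ∀ v ∈ V, Dᴴ *ᵥ v ∈ W := by
    intro v hv
    refine Submodule.iSup_induction (motive := fun v => Dᴴ *ᵥ v ∈ W) _ hv ?_ ?_ ?_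
    · intro w v hv
      rw [hW]
      exact h.mulVec_mem_map w.2 hv
    · rw [Matrix.mulVec_zero]; exact W.zero_mem
    · intro v v' h1 h2
      rw [Matrix.mulVec_add]; exact W.add_mem h1 h2
  have hC : ∀ v ∈ V, C *ᵥ v ∈ W := by
    intro v hv
    have h1 : C *ᵥ v = N *ᵥ v - Dᴴ *ᵥ v := by
      rw [hN, Matrix.add_mulVec, add_sub_cancel_right]
    rw [h1]
    exact W.sub_mem (hW ▸ Submodule.mem_map_of_mem (f := f) hv) (hD v hv)
  obtain ⟨U, hU, hUW⟩ := exists_orthogonal W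
  have hker : LinearMap.ker N.mulVecLin ≤ V := fun v hv =>
    mem_pencilKernelSum (w := 1) (by simp) (by rw [one_smul]; exact hv)
  have hrank : N.rank = p := by
    have := h.rank (w := 1) (by simp)
    rwa [one_smul] at this
  -- V contains the whole kernel of N, of dimension s - p. Hence dim U + dim V = r - dim W + dim V =
  -- r + s - p.
  have hdim : Module.finrank ℂ W + (s - p) = Module.finrank ℂ V := by
    have h1 := LinearMap.finrank_range_add_finrank_ker (f.domRestrict V)
    have h2 := LinearMap.finrank_range_add_finrank_ker f
    rw [Module.finrank_fintype_fun_eq_card, Fintype.card_fin] at h2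
    have h3 : Module.finrank ℂ (LinearMap.range f) = p := hrank
    have h4 : Module.finrank ℂ (LinearMap.ker (f.domRestrict V)) =
        Module.finrank ℂ (LinearMap.ker f) := by
      rw [LinearMap.ker_domRestrict]
      exact (Submodule.comapSubtypeEquivOfLe hker).finrank_eq
    rw [LinearMap.range_domRestrict, ← hW] at h1
    omega
  let e := LinearEquiv.sumArrowLequivProdArrow (Fin r) (Fin s) ℂ ℂ
  let S : Submodule ℂ (Fin r ⊕ Fin s → ℂ) := (U.prod V).comap e.toLinearMap
  have hS : Module.finrank ℂ S = Module.finrank ℂ U + Module.finrank ℂ V := by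
    have h1 : S = (U.prod V).map e.symm.toLinearMap := Submodule.comap_equiv_eq_map_symm e _
    rw [h1, LinearEquiv.finrank_map_eq, finrank_submodule_prod]
  refine mem_rankNumRange_of_isotropic ⟨S, ?_, fun x hx y hy => ?_⟩
  · have := h.card
    rw [Fintype.card_fin] at hU
    omega
  · have hxU : x ∘ Sum.inl ∈ U := hx.1
    have hxV : x ∘ Sum.inr ∈ V := hx.2
    have hyU : y ∘ Sum.inl ∈ U := hy.1
    have hyV : y ∘ Sum.inr ∈ V := hy.2
    rw [scalarDiagBlocks_sub_smul_one, sub_self, scalarDiagBlocks_form, zero_mul, zero_mul,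
      zero_add, add_zero, hUW _ hxU _ (hC _ hyV), zero_add, ← star_star (star _ ⬝ᵥ _),
      star_dotProduct_mulVec_conj, hUW _ hyU _ (hD _ hxV), star_zero]

end EqualFoci

/-! ### Assembly of the cases. -/

section MainTheorem

variable {r s : ℕ} {C : Matrix (Fin r) (Fin s) ℂ} {D : Matrix (Fin s) (Fin r) ℂ} {p q : ℕ}
  {μ : Fin p → ℝ}

theorem ConstantSpectrum.card_lt_filter (h : ConstantSpectrum C D μ q) (j : Fin p) :
    (Finset.univ.filter fun i => μ j < μ i).card < (j : ℕ) + 1 := by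
  have hsub : (Finset.univ.filter fun i => μ j < μ i) ⊆ Finset.Iio j := fun i hi => by
    rw [Finset.mem_Iio]
    by_contra! hle
    exact absurd (h.anti hle) (not_le.mpr (Finset.mem_filter.mp hi).2)
  have := Finset.card_le_card hsub
  rw [Fin.card_Iio] at this
  omega

theorem ConstantSpectrum.rankNumRange_eq_ellipticalDisc (hsr : s ≤ r)
    (h : ConstantSpectrum C D μ q) (α β : ℂ) (j : Fin p) :
    rankNumRange ((j : ℕ) + 1) (scalarDiagBlocks α β C D) = ellipticalDisc α β (√(μ j)) := by
  refine Set.Subset.antisymm (fun z hz => ?_) (h.ellipticalDisc_subset hsr j (h.pos j) α β)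
  rw [mem_ellipticalDisc_iff, Real.sq_sqrt (h.pos j).le]
  exact h.le_of_mem_rankNumRange (h.pos j).le (h.card_lt_filter j) hz

theorem ConstantSpectrum.rankNumRange_eq_segment (hsr : s ≤ r) (h : ConstantSpectrum C D μ q)
    (α β : ℂ) {k : ℕ} (hpk : p < k) (hk : k ≤ s) :
    rankNumRange k (scalarDiagBlocks α β C D) = segment ℝ α β := by
  refine Set.Subset.antisymm (fun z hz => ?_) (segment_subset_rankNumRange hsr hk α β C D)
  rw [← ellipticalDisc_zero, mem_ellipticalDisc_iff, zero_pow two_ne_zero]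
  refine h.le_of_mem_rankNumRange le_rfl ?_ hz
  refine (Finset.card_filter_le _ _).trans_lt ?_
  rwa [Finset.card_univ, Fintype.card_fin]

theorem ConstantSpectrum.numRange_eq (hsr : s ≤ r) (hs : 0 < s) (h : ConstantSpectrum C D μ q)
    (α β : ℂ) : numRange (scalarDiagBlocks α β C D) = ellipticalDisc α β ‖C + Dᴴ‖ := by
  rw [numRange_eq_rankNumRange_one]
  rcases Nat.eq_zero_or_pos p with hp | hp
  · rw [h.add_conjTranspose_eq_zero hp, norm_zero, ellipticalDisc_zero]
    exact h.rankNumRange_eq_segment hsr α β (by omega) hs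
  · have h1 := h.rankNumRange_eq_ellipticalDisc hsr α β ⟨0, hp⟩
    rwa [← h.l2_opNorm_sq hp, Real.sqrt_sq (norm_nonneg _)] at h1

theorem rankNumRange_eq_of_constantSpectrum (hs : 0 < s) (hsr : s ≤ r)
    (h : ConstantSpectrum C D μ q) (α β : ℂ) :
    (∀ j : Fin p, rankNumRange ((j : ℕ) + 1) (scalarDiagBlocks α β C D) =
      ellipticalDisc α β (Real.sqrt (μ j))) ∧
    (∀ k : ℕ, p < k → k ≤ min r s →
      rankNumRange k (scalarDiagBlocks α β C D) = segment ℝ α β) ∧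
    (∀ k : ℕ, s < k → k ≤ r → rankNumRange k (scalarDiagBlocks α β C D) = {α}) ∧
    (∀ k : ℕ, r < k → k ≤ s → rankNumRange k (scalarDiagBlocks α β C D) = {β}) ∧
    (∀ k : ℕ, max r s < k → k ≤ r + s → ¬ (α = β ∧ k ≤ r + s - p) →
      rankNumRange k (scalarDiagBlocks α β C D) = ∅) ∧
    (∀ k : ℕ, max r s < k → α = β → k ≤ r + s - p →
      rankNumRange k (scalarDiagBlocks α β C D) = {α}) ∧
    numRange (scalarDiagBlocks α β C D) = ellipticalDisc α β ‖C + Dᴴ‖ := by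
  refine ⟨h.rankNumRange_eq_ellipticalDisc hsr α β,
    fun k hpk hk => h.rankNumRange_eq_segment hsr α β hpk (hk.trans (min_le_right _ _)),
    fun k hsk hk => ?_, fun k hrk hk => by omega, fun k hk _ hne => ?_, fun k hk hαβ hkp => ?_,
    h.numRange_eq hsr hs α β⟩
  · exact Set.Subset.antisymm (fun z hz => eq_left_of_mem_rankNumRange hsk hz)
      (Set.singleton_subset_iff.mpr (left_mem_rankNumRange hk α β C D))
  · rw [Set.eq_empty_iff_forall_notMem]
    intro z hz
    have h1 := eq_left_of_mem_rankNumRange (lt_of_le_of_lt (le_max_right _ _) hk) hz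
    have h2 := eq_right_of_mem_rankNumRange (lt_of_le_of_lt (le_max_left _ _) hk) hz
    obtain rfl : α = β := h1.symm.trans h2
    subst h1
    exact hne ⟨rfl, h.le_sub_of_mem_rankNumRange hz⟩
  · subst hαβ
    exact Set.Subset.antisymm
      (fun z hz => eq_left_of_mem_rankNumRange (lt_of_le_of_lt (le_max_right _ _) hk) hz)
      (Set.singleton_subset_iff.mpr (h.left_mem_rankNumRange hkp α))

end MainTheorem


theorem theorem3p6 (r s : ℕ) (hr : 0 < r) (hs : 0 < s) (α β : ℂ)
    (C : Matrix (Fin r) (Fin s) ℂ) (D : Matrix (Fin s) (Fin r) ℂ)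
    (p : ℕ) (μ : Fin p → ℝ)
    -- `M(θ)` is `M_{C,D}(θ)` if `n ≤ 2r`, that is `s ≤ r`, and `M_{D,C}(θ)` otherwise
    (hM : if s ≤ r
      then SpectrumIndependent (blockM C D) ∧ ListsNonzeroEigenvalues (blockM C D 0) μ
      else SpectrumIndependent (blockM D C) ∧ ListsNonzeroEigenvalues (blockM D C 0) μ) :
    (∀ j : Fin p, rankNumRange ((j : ℕ) + 1) (scalarDiagBlocks α β C D) =
      ellipticalDisc α β (Real.sqrt (μ j))) ∧
    (∀ k : ℕ, p < k → k ≤ min r s →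
      rankNumRange k (scalarDiagBlocks α β C D) = segment ℝ α β) ∧
    (∀ k : ℕ, s < k → k ≤ r → rankNumRange k (scalarDiagBlocks α β C D) = {α}) ∧
    (∀ k : ℕ, r < k → k ≤ s → rankNumRange k (scalarDiagBlocks α β C D) = {β}) ∧
    (∀ k : ℕ, max r s < k → k ≤ r + s → ¬ (α = β ∧ k ≤ r + s - p) →
      rankNumRange k (scalarDiagBlocks α β C D) = ∅) ∧
    (∀ k : ℕ, max r s < k → α = β → k ≤ r + s - p →
      rankNumRange k (scalarDiagBlocks α β C D) = {α}) ∧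
    numRange (scalarDiagBlocks α β C D) = ellipticalDisc α β ‖C + Dᴴ‖ := by
  by_cases hsr : s ≤ r
  · rw [if_pos hsr] at hM
    obtain ⟨q, h⟩ := exists_constantSpectrum hM.1 hM.2
    exact rankNumRange_eq_of_constantSpectrum hs hsr h α β
  · rw [if_neg hsr] at hM
    obtain ⟨q, h⟩ := exists_constantSpectrum hM.1 hM.2
    -- Exchanging the blocks swaps the foci and the roles of C and D, so the two singleton cases
    -- trade places.
    obtain ⟨h1, h2, h3, h4, h5, h6, h7⟩ :=
      rankNumRange_eq_of_constantSpectrum hr (le_of_not_ge hsr) h β α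
    have hnum : numRange (scalarDiagBlocks α β C D) = numRange (scalarDiagBlocks β α D C) := by
      rw [numRange_eq_rankNumRange_one, numRange_eq_rankNumRange_one,
        rankNumRange_scalarDiagBlocks_swap]
    have hnorm : ‖C + Dᴴ‖ = ‖D + Cᴴ‖ := by
      rw [← Matrix.l2_opNorm_conjTranspose (C + Dᴴ), Matrix.conjTranspose_add,
        Matrix.conjTranspose_conjTranspose, add_comm]
    simp only [rankNumRange_scalarDiagBlocks_swap _ α β C D, ellipticalDisc_comm β α, min_comm s r,
      max_comm s r, add_comm s r, segment_symm ℝ β α] at h1 h2 h3 h4 h5 h6 h7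
    refine ⟨h1, h2, h4, h3, fun k hk hk' hne => h5 k hk hk' fun h => hne ⟨h.1.symm, h.2⟩,
      fun k hk hαβ hkp => ?_, ?_⟩
    · rw [h6 k hk hαβ.symm hkp, hαβ]
    · rw [hnum, h7, hnorm]
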